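/- **Setting.** Let $d_x,d_u\ge 1$, $d=\max(d_x,d_u)$, and consider the linear dynamical system $x_{t+1}=Ax_t+Bu_t+w_t$, $x_1=0$, with real matrices $A\in\mathbb R^{d_x\times d_x}$, $B\in\mathbb R^{d_x\times d_u}$. All matrix norms are spectral norms. The perturbations $w_t$ are i.i.d. with a law $\mathcal D_w$ such that $\mathbb E[w_t]=0$, $\mathbb E[w_tw_t^\top]\succeq\sigma^2 I$ ($\sigma>0$), and $\|w_t\|\le W$ almost surely; put $w_s=0$ for $s\le 0$. For $\kappa\ge 1$ and $0<\gamma<1$, a real matrix $K$ is $(\kappa,\gamma)$-diagonal strongly stable if $A-BK=QLQ^{-1}$ with a complex diagonal $L$ and a non-singular complex $Q$ with $\|L\|\le 1-\gamma$, $\|K\|\le\kappa$, $\|Q\|,\|Q^{-1}\|\le\kappa$. Let $\mathcal K$ be the set of these matrices and fix $\mathbb K\in\mathcal K$. Let $\kappa_B\ge\|B\|$ be an upper bound with $\kappa_B(1-\gamma)\ge 2$. The costs $c_t(x,u)$ are a fixed sequence of differentiable functions that are $\alpha$-strongly convex in $(x,u)$ ($\alpha>0$) and satisfy, for every $D\ge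 W$, $\|\nabla_xc_t(x,u)\|,\|\nabla_uc_t(x,u)\|\le GD$ whenever $\|x\|,\|u\|\le D$. For a controller $\mathcal A$ let $J_T(\mathcal A)=\mathbb E\big[\sum_{t=1}^Tc_t(x_t,u_t)\big]$, and let $J_T(K)$ be the cost of the controller $u_t=-Kx_t$. **Algorithm.** Let $T\ge 2$, $H=\lceil\gamma^{-1}\log(T\kappa^2)\rceil$, and $\mathcal M=\{M=(M^{[0]},\dots,M^{[H-1]}):M^{[i-1]}\in\mathbb R^{d_u\times d_x},\ \|M^{[i-1]}\|\le\kappa^3\kappa_B(1-\gamma)^i \text{ for } 1\le i\le H\}$; write $M_{\mathrm{vec}}$ for the flattening of $M$. With $\tilde A=A-B\mathbb K$ and $$\Psi_i(M)=\tilde A^i\mathbf 1_{i\le H}+\sum_{j=0}^H\tilde A^jBM^{[i-j-1]}\mathbf 1_{i-j\in[1,H]},$$ and independent $w_0,\dots,w_{2H-1}\sim\mathcal D_w$, the surrogate state, action and cost are $$y(M)=\sum_{i=0}^{2H-1}\Psi_i(M)w_{2H-1-i},\qquad v(M)=-\mathbb Ky(M)+\sum_{i=1}^HM^{[i-1]}w_{2H-i},\qquad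 f_t(M)=\mathbb E[c_t(y(M),v(M))],$$ and $J$ is the (random) Jacobian of the affine map $M_{\mathrm{vec}}\mapsto(y(M),v(M))$. The online natural gradient algorithm $\mathcal A$ starts from an arbitrary $M_1\in\mathcal M$, plays $u_t=-\mathbb Kx_t+\sum_{i=1}^HM_t^{[i-1]}w_{t-i}$, and updates $$[M_{t+1}]_{\mathrm{vec}}=\Pi_{\mathcal M}\Big([M_t]_{\mathrm{vec}}-\eta_t\,(\mathbb E[J^\top J])^{-1}\nabla_{M_{\mathrm{vec}}}f_t(M_t)\Big),\qquad \eta_t=\frac{s}{\alpha t},$$ where $s\ge1$ is a constant and $\Pi_{\mathcal M}$ is the projection onto $\mathcal M$ in the norm $\|m\|^2=m^\top\mathbb E[J^\top J]\,m$. **Claim.** There are universal constants $C>0$ and $n\in\mathbb N$ such that, in every such situation, $$\mathbb E[J^\top J]\succeq\frac{\gamma^2\sigma^2}{36\,\kappa^{10}}\,I$$ and $$J_T(\mathcal A)-\min_{K\in\mathcal K}J_T(K)\ \le\ C\,(\gamma^{-1}\kappa_B\,\kappa\,d)^n\, s\,\frac{G^2W^4}{\alpha\sigma^2}\,\log^7T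 .$$ -/

import Mathlib

open MeasureTheory ProbabilityTheory
open scoped Matrix Matrix.Norms.L2Operator

noncomputable section

namespace OnlineControl

/-- `ℝⁿ` with the Euclidean norm. -/
abbrev Vec (n : ℕ) := EuclideanSpace ℝ (Fin n)

/-- Flattened disturbance-action parameters `M_vec`, with the Euclidean norm; the coordinate
`(i, a, b)` is the entry `(a, b)` of the `du × dx` matrix `M^{[i]}`, `i = 0, …, H - 1`. -/
abbrev Param (H du dx : ℕ) := EuclideanSpace ℝ (Fin H × Fin du × Fin dx)

/-- The matrix `M^{[i]}` of a flattened parameter. -/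
def block {H du dx : ℕ} (M : Param H du dx) (i : Fin H) : Matrix (Fin du) (Fin dx) ℝ :=
  Matrix.of fun a b => M (i, a, b)

/-- The action of a matrix on a Euclidean vector. -/
abbrev app {m n : ℕ} (A : Matrix (Fin m) (Fin n) ℝ) (x : Vec n) : Vec m :=
  Matrix.toEuclideanLin A x

/-- `K` is `(κ, γ)`-diagonal strongly stable for the dynamics `(A, B)`. All matrix norms are
spectral norms. -/
def DiagStronglyStable {dx du : ℕ} (A : Matrix (Fin dx) (Fin dx) ℝ)
    (B : Matrix (Fin dx) (Fin du) ℝ) (κ γ : ℝ) (K : Matrix (Fin du) (Fin dx) ℝ) : Prop :=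
  ∃ (L : Fin dx → ℂ) (Q : Matrix (Fin dx) (Fin dx) ℂ),
    IsUnit Q.det ∧
    (A - B * K).map Complex.ofReal = Q * Matrix.diagonal L * Q⁻¹ ∧
    ‖(Matrix.diagonal L : Matrix (Fin dx) (Fin dx) ℂ)‖ ≤ 1 - γ ∧
    ‖K‖ ≤ κ ∧ ‖Q‖ ≤ κ ∧ ‖Q⁻¹‖ ≤ κ

/-- Covariance matrix `E[w wᵀ]` of a centred law `μ`. -/
def secondMoment {dx : ℕ} (μ : Measure (Vec dx)) : Matrix (Fin dx) (Fin dx) ℝ :=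
  Matrix.of fun a b => ∫ x, x a * x b ∂μ

/-- The law of one perturbation: zero mean, `E[w wᵀ] ⪰ σ² I`, and `‖w‖ ≤ W` almost surely. -/
structure NoiseLaw {dx : ℕ} (μ : Measure (Vec dx)) (σ W : ℝ) : Prop where
  prob : IsProbabilityMeasure μ
  bounded : ∀ᵐ x ∂μ, ‖x‖ ≤ W
  mean_zero : ∫ x, x ∂μ = 0
  cov : (secondMoment μ - (σ ^ 2) • (1 : Matrix (Fin dx) (Fin dx) ℝ)).PosSemidef

/-- Conditions on one cost function: differentiable, `α`-strongly convex jointly in `(x, u)` for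
the Euclidean norm, and with both partial gradients bounded by `G D` as long as
`‖x‖, ‖u‖ ≤ D`. The last condition is only asked for scales `D` that are at least the noise
bound `W`, so the cost need not be minimal at the origin. -/
structure CostCondition {dx du : ℕ} (c : Vec dx → Vec du → ℝ) (α G W : ℝ) : Prop where
  differentiable : Differentiable ℝ (fun z : Vec dx × Vec du => c z.1 z.2)
  strongConvex :
    StrongConvexOn Set.univ α (fun z : WithLp 2 (Vec dx × Vec du) => c z.fst z.snd)
  grad_bound : ∀ D : ℝ, W ≤ D → ∀ (x : Vec dx) (u : Vec du), ‖x‖ ≤ D → ‖u‖ ≤ D →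
    ‖gradient (fun x' => c x' u) x‖ ≤ G * D ∧ ‖gradient (fun u' => c x u') u‖ ≤ G * D

/-! ### The controlled system -/

/-- The state `x_t`, `t ≥ 1`, of `x_{t+1} = A x_t + B u_t + w_t`, `x_1 = 0`, where the action is
`u_t = π t x_t` (the value at `t = 0` is not used). -/
def state {dx du : ℕ} (A : Matrix (Fin dx) (Fin dx) ℝ) (B : Matrix (Fin dx) (Fin du) ℝ)
    (π : ℕ → Vec dx → Vec du) (w : ℕ → Vec dx) : ℕ → Vec dx
  | 0 => 0
  | 1 => 0
  | t + 2 =>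
      app A (state A B π w (t + 1)) + app B (π (t + 1) (state A B π w (t + 1))) + w (t + 1)

/-- `J_T = E[∑_{t=1}^T c_t(x_t, u_t)]` for a controller that, given the noise `w`, plays
`u_t = π w t x_t`. -/
def expectedCost {dx du : ℕ} {Ω : Type*} [MeasurableSpace Ω] (P : Measure Ω)
    (w : ℕ → Ω → Vec dx)
    (A : Matrix (Fin dx) (Fin dx) ℝ) (B : Matrix (Fin dx) (Fin du) ℝ)
    (c : ℕ → Vec dx → Vec du → ℝ) (T : ℕ)
    (π : (ℕ → Vec dx) → ℕ → Vec dx → Vec du) : ℝ :=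
  ∫ ω, ∑ t ∈ Finset.Icc 1 T,
    c t (state A B (π fun s => w s ω) (fun s => w s ω) t)
      (π (fun s => w s ω) t (state A B (π fun s => w s ω) (fun s => w s ω) t)) ∂P

/-- The linear controller `u_t = -K x_t`. -/
def linearController {dx du : ℕ} (K : Matrix (Fin du) (Fin dx) ℝ) :
    (ℕ → Vec dx) → ℕ → Vec dx → Vec du :=
  fun _ _ x => -app K x

/-- The disturbance-action controller `u_t = -𝕂 x_t + ∑_{i=1}^H M_t^{[i-1]} w_{t-i}`, where
`w_s = 0` for `s ≤ 0`. It only uses `w_s` for `1 ≤ s < t`, and these are known at time `t`, as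
`w_s = x_{s+1} - A x_s - B u_s`. -/
def disturbanceActionController {dx du H : ℕ} (K : Matrix (Fin du) (Fin dx) ℝ)
    (M : ℕ → Param H du dx) : (ℕ → Vec dx) → ℕ → Vec dx → Vec du :=
  fun w t x => -app K x +
    ∑ i : Fin H, if (i : ℕ) + 1 < t then app (block (M t) i) (w (t - ((i : ℕ) + 1))) else 0

/-! ### Surrogate state, action and cost -/

/-- The transfer matrix
`Ψ_i(M) = Ã^i 1_{i ≤ H} + ∑_{j=0}^H Ã^j B M^{[i-j-1]} 1_{i-j ∈ [1,H]}` with `Ã = A - B 𝕂`. -/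
def transfer {dx du H : ℕ} (A : Matrix (Fin dx) (Fin dx) ℝ) (B : Matrix (Fin dx) (Fin du) ℝ)
    (K : Matrix (Fin du) (Fin dx) ℝ) (M : Param H du dx) (i : ℕ) :
    Matrix (Fin dx) (Fin dx) ℝ :=
  (if i ≤ H then (A - B * K) ^ i else 0) +
    ∑ j ∈ Finset.range (H + 1),
      if h : j < i ∧ i - j ≤ H then
        (A - B * K) ^ j * B * block M ⟨i - j - 1, by omega⟩
      else 0

/-- Surrogate state `y(M) = ∑_{i=0}^{2H-1} Ψ_i(M) w_{2H-1-i}`, driven by `w_0, …, w_{2H-1}`. -/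
def surrogateState {dx du H : ℕ} (A : Matrix (Fin dx) (Fin dx) ℝ)
    (B : Matrix (Fin dx) (Fin du) ℝ) (K : Matrix (Fin du) (Fin dx) ℝ) (M : Param H du dx)
    (w : Fin (2 * H) → Vec dx) : Vec dx :=
  ∑ i : Fin (2 * H), app (transfer A B K M i) (w i.rev)

/-- Surrogate action `v(M) = -𝕂 y(M) + ∑_{i=1}^H M^{[i-1]} w_{2H-i}`. -/
def surrogateAction {dx du H : ℕ} (A : Matrix (Fin dx) (Fin dx) ℝ)
    (B : Matrix (Fin dx) (Fin du) ℝ) (K : Matrix (Fin du) (Fin dx) ℝ) (M : Param H du dx)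
    (w : Fin (2 * H) → Vec dx) : Vec du :=
  -app K (surrogateState A B K M w) +
    ∑ i : Fin H, app (block M i) (w ⟨2 * H - ((i : ℕ) + 1), by have := i.isLt; omega⟩)

/-- Surrogate cost `f(M) = E[c(y(M), v(M))]`, the expectation being over `2H` independent noise
vectors of law `μ`. -/
def surrogateCost {dx du H : ℕ} (μ : Measure (Vec dx)) (A : Matrix (Fin dx) (Fin dx) ℝ)
    (B : Matrix (Fin dx) (Fin du) ℝ) (K : Matrix (Fin du) (Fin dx) ℝ)
    (c : Vec dx → Vec du → ℝ) (M : Param H du dx) : ℝ :=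
  ∫ w, c (surrogateState A B K M w) (surrogateAction A B K M w)
    ∂(Measure.pi fun _ : Fin (2 * H) => μ)

/-- The coordinates of `z(M) = (y(M), v(M))`. -/
def surrogatePair {dx du H : ℕ} (A : Matrix (Fin dx) (Fin dx) ℝ)
    (B : Matrix (Fin dx) (Fin du) ℝ) (K : Matrix (Fin du) (Fin dx) ℝ) (M : Param H du dx)
    (w : Fin (2 * H) → Vec dx) : Fin dx ⊕ Fin du → ℝ :=
  Sum.elim (fun r => surrogateState A B K M w r) (fun r => surrogateAction A B K M w r)

/-- The random Jacobian `J` of `z(M)` with respect to `M_vec`. Since `z` is affine in `M_vec`, the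
column of `J` that belongs to the coordinate `p` is `z(e_p) - z(0)`. -/
def jacobian {dx du H : ℕ} (A : Matrix (Fin dx) (Fin dx) ℝ)
    (B : Matrix (Fin dx) (Fin du) ℝ) (K : Matrix (Fin du) (Fin dx) ℝ)
    (w : Fin (2 * H) → Vec dx) :
    Matrix (Fin dx ⊕ Fin du) (Fin H × Fin du × Fin dx) ℝ :=
  Matrix.of fun r p =>
    surrogatePair A B K (EuclideanSpace.single p 1) w r - surrogatePair A B K 0 w r

/-- The preconditioner `E[Jᵀ J]`. -/
def expectedGram {dx du : ℕ} (H : ℕ) (μ : Measure (Vec dx)) (A : Matrix (Fin dx) (Fin dx) ℝ)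
    (B : Matrix (Fin dx) (Fin du) ℝ) (K : Matrix (Fin du) (Fin dx) ℝ) :
    Matrix (Fin H × Fin du × Fin dx) (Fin H × Fin du × Fin dx) ℝ :=
  Matrix.of fun p q => ∫ w, ((jacobian A B K w)ᵀ * jacobian A B K w) p q
    ∂(Measure.pi fun _ : Fin (2 * H) => μ)

/-! ### The online natural gradient algorithm -/

/-- The feasible set `{M : ‖M^{[i-1]}‖ ≤ κ³ κ_B (1 - γ)^i, i = 1, …, H}`. -/
def feasible (H du dx : ℕ) (κ κB γ : ℝ) : Set (Param H du dx) :=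
  {M | ∀ i : Fin H, ‖block M i‖ ≤ κ ^ 3 * κB * (1 - γ) ^ ((i : ℕ) + 1)}

/-- The squared norm `‖m‖_P² = mᵀ P m`. -/
def sqNorm {ι : Type*} [Fintype ι] (P : Matrix ι ι ℝ) (m : EuclideanSpace ℝ ι) : ℝ :=
  m.ofLp ⬝ᵥ (P *ᵥ m.ofLp)

/-- `N` is the projection of `Y` onto `S` in the norm `‖·‖_P`. -/
def IsProj {ι : Type*} [Fintype ι] (P : Matrix ι ι ℝ) (S : Set (EuclideanSpace ℝ ι))
    (Y N : EuclideanSpace ℝ ι) : Prop :=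
  N ∈ S ∧ ∀ N' ∈ S, sqNorm P (N - Y) ≤ sqNorm P (N' - Y)

/-- `M_1, …, M_T` are the iterates of the online natural gradient update
`M_{t+1} = Π(M_t - η_t (E[Jᵀ J])⁻¹ ∇ f_t(M_t))`, from an arbitrary feasible `M_1`, where `Π` is
the projection onto the feasible set in the norm given by `E[Jᵀ J]`. -/
def NaturalGradientIterates {dx du H : ℕ} (μ : Measure (Vec dx))
    (A : Matrix (Fin dx) (Fin dx) ℝ) (B : Matrix (Fin dx) (Fin du) ℝ)
    (K : Matrix (Fin du) (Fin dx) ℝ) (κ κB γ : ℝ) (c : ℕ → Vec dx → Vec du → ℝ)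
    (η : ℕ → ℝ) (T : ℕ) (M : ℕ → Param H du dx) : Prop :=
  M 1 ∈ feasible H du dx κ κB γ ∧
  ∀ t : ℕ, 1 ≤ t → t < T →
    IsProj (expectedGram H μ A B K) (feasible H du dx κ κB γ)
      (M t - η t • WithLp.toLp 2 ((expectedGram H μ A B K)⁻¹ *ᵥ
        (gradient (surrogateCost μ A B K (c t)) (M t)).ofLp))
      (M (t + 1))

end OnlineControl

end

/-!
Since the blocks of `M` act on independent noise vectors with non-degenerate covariance, the Gram
matrix `E[Jᵀ J]` is bounded below. The surrogate cost is the expectation of a strongly convex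
function of the random affine map `M ↦ (y(M), v(M))`, hence strongly convex in the norm of the
Gram matrix itself, and its gradient is bounded in the dual norm; projected gradient descent
preconditioned by the Gram matrix therefore has logarithmic regret on the surrogate costs.

Surrogate and true costs differ little: noise older than `H` steps enters through powers of the
closed loop matrix, which decay geometrically, and the iterates move slowly. A competing linear
controller `K'` is imitated by the fixed parameter `M^{[i-1]} = (K - K') (A - B K')^{i-1}`, up to
a term of order `(1 - γ)^H ≤ 1 / T`.
-/

namespace OnlineControl

/-! ### Matrices acting on Euclidean vectors -/

section Matrices

variable {l m n : ℕ}

theorem norm_app_le (A : Matrix (Fin m) (Fin n) ℝ) (x : Vec n) : ‖app A x‖ ≤ ‖A‖ * ‖x‖ :=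
  Matrix.l2_opNorm_mulVec A x

theorem norm_app_le_of_le {A : Matrix (Fin m) (Fin n) ℝ} {x : Vec n} {a b : ℝ} (hA : ‖A‖ ≤ a)
    (hx : ‖x‖ ≤ b) : ‖app A x‖ ≤ a * b :=
  (norm_app_le A x).trans (mul_le_mul hA hx (norm_nonneg _) ((norm_nonneg _).trans hA))

theorem app_apply (A : Matrix (Fin m) (Fin n) ℝ) (x : Vec n) (a : Fin m) :
    app A x a = ∑ b, A a b * x b := by
  simp [app, Matrix.toLpLin_apply, Matrix.mulVec, dotProduct]

theorem app_mul (A : Matrix (Fin l) (Fin m) ℝ) (B : Matrix (Fin m) (Fin n) ℝ) (x : Vec n) :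
    app (A * B) x = app A (app B x) := by
  simp [app, Matrix.toLpLin_apply]

theorem app_one (x : Vec n) : app (1 : Matrix (Fin n) (Fin n) ℝ) x = x := by
  simp [app]

theorem app_sub_left (A B : Matrix (Fin m) (Fin n) ℝ) (x : Vec n) :
    app (A - B) x = app A x - app B x := by
  simp [app]

theorem app_add_left (A B : Matrix (Fin m) (Fin n) ℝ) (x : Vec n) :
    app (A + B) x = app A x + app B x := by
  simp [app]

theorem app_zero (A : Matrix (Fin m) (Fin n) ℝ) : app A 0 = 0 := map_zero _

theorem app_add (A : Matrix (Fin m) (Fin n) ℝ) (x y : Vec n) : app A (x + y) = app A x + app A y :=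
  map_add _ _ _

theorem app_sub (A : Matrix (Fin m) (Fin n) ℝ) (x y : Vec n) : app A (x - y) = app A x - app A y :=
  map_sub _ _ _

theorem app_sum {ι : Type*} (A : Matrix (Fin m) (Fin n) ℝ) (s : Finset ι) (f : ι → Vec n) :
    app A (∑ i ∈ s, f i) = ∑ i ∈ s, app A (f i) :=
  map_sum _ _ _

theorem continuous_app (A : Matrix (Fin m) (Fin n) ℝ) : Continuous (app A) :=
  LinearMap.continuous_of_finiteDimensional _

end Matrices

/-! ### Stable feedback matrices -/

section Stability

variable {m n : ℕ}

theorem norm_le_norm_map_ofReal (A : Matrix (Fin m) (Fin n) ℝ) :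
    ‖A‖ ≤ ‖A.map Complex.ofReal‖ := by
  let toComplex {k : ℕ} (x : Vec k) : EuclideanSpace ℂ (Fin k) := WithLp.toLp 2 fun i => (x i : ℂ)
  have norm_toComplex {k : ℕ} (x : Vec k) : ‖toComplex x‖ = ‖x‖ := by
    simp [toComplex, EuclideanSpace.norm_eq]
  rw [Matrix.l2_opNorm_def]
  refine ContinuousLinearMap.opNorm_le_bound _ (norm_nonneg _) fun x => ?_
  have h := Matrix.l2_opNorm_mulVec (A.map Complex.ofReal) (toComplex x)
  rw [norm_toComplex] at h
  refine le_trans (le_of_eq ?_) h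
  rw [← norm_toComplex]
  congr 1
  ext i
  simp [toComplex, Matrix.toLpLin_apply, Matrix.mulVec, dotProduct]

theorem norm_diagonal_pow_le {L : Fin n → ℂ} {r : ℝ}
    (hL : ‖(Matrix.diagonal L : Matrix (Fin n) (Fin n) ℂ)‖ ≤ r) (k : ℕ) :
    ‖(Matrix.diagonal (L ^ k) : Matrix (Fin n) (Fin n) ℂ)‖ ≤ r ^ k := by
  have hr : 0 ≤ r := (norm_nonneg _).trans hL
  rw [Matrix.l2_opNorm_diagonal] at hL ⊢
  refine (pi_norm_le_iff_of_nonneg (pow_nonneg hr k)).2 fun i => ?_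
  rw [Pi.pow_apply, norm_pow]
  exact pow_le_pow_left₀ (norm_nonneg _) ((norm_le_pi_norm L i).trans hL) k

theorem norm_pow_le_of_eq_conj_diagonal {F : Matrix (Fin n) (Fin n) ℝ} {L : Fin n → ℂ}
    {Q : Matrix (Fin n) (Fin n) ℂ} {κ r : ℝ} (hQ : IsUnit Q.det)
    (hF : F.map Complex.ofReal = Q * Matrix.diagonal L * Q⁻¹)
    (hL : ‖(Matrix.diagonal L : Matrix (Fin n) (Fin n) ℂ)‖ ≤ r) (hκ : ‖Q‖ ≤ κ)
    (hκ' : ‖Q⁻¹‖ ≤ κ) (k : ℕ) : ‖F ^ k‖ ≤ κ ^ 2 * r ^ k := by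
  have map_pow_eq : (F ^ k).map Complex.ofReal = Q * Matrix.diagonal (L ^ k) * Q⁻¹ := by
    rw [← Matrix.diagonal_pow]
    calc (F ^ k).map Complex.ofReal = F.map Complex.ofReal ^ k :=
          map_pow (Complex.ofRealHom.mapMatrix) F k
      _ = (Q * Matrix.diagonal L * Q⁻¹) ^ k := by rw [hF]
      _ = Q * Matrix.diagonal L ^ k * Q⁻¹ := Units.conj_pow (Matrix.nonsingInvUnit Q hQ) _ k
  have hd := norm_diagonal_pow_le hL k
  have hκ0 : 0 ≤ κ := (norm_nonneg _).trans hκ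
  calc ‖F ^ k‖ ≤ ‖(F ^ k).map Complex.ofReal‖ := norm_le_norm_map_ofReal _
    _ = ‖Q * Matrix.diagonal (L ^ k) * Q⁻¹‖ := by rw [map_pow_eq]
    _ ≤ ‖Q‖ * ‖(Matrix.diagonal (L ^ k) : Matrix (Fin n) (Fin n) ℂ)‖ * ‖Q⁻¹‖ :=
      (norm_mul_le _ _).trans (mul_le_mul_of_nonneg_right (norm_mul_le _ _) (norm_nonneg _))
    _ ≤ κ * r ^ k * κ := by have := (norm_nonneg _).trans hd; gcongr
    _ = κ ^ 2 * r ^ k := by ring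

/-- Strong stability without diagonalizability: `‖K‖ ≤ κ`, and the powers of the closed-loop
matrix `A - B K` decay at the rate `1 - γ` up to the factor `κ²`. -/
structure PowerStable {dx du : ℕ} (A : Matrix (Fin dx) (Fin dx) ℝ)
    (B : Matrix (Fin dx) (Fin du) ℝ) (κ γ : ℝ) (K : Matrix (Fin du) (Fin dx) ℝ) : Prop where
  norm_le : ‖K‖ ≤ κ
  norm_pow_le : ∀ k : ℕ, ‖(A - B * K) ^ k‖ ≤ κ ^ 2 * (1 - γ) ^ k

theorem DiagStronglyStable.powerStable {dx du : ℕ} {A : Matrix (Fin dx) (Fin dx) ℝ}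
    {B : Matrix (Fin dx) (Fin du) ℝ} {κ γ : ℝ} {K : Matrix (Fin du) (Fin dx) ℝ}
    (h : DiagStronglyStable A B κ γ K) : PowerStable A B κ γ K :=
  let ⟨_, _, hQ, hF, hL, hK, hκ, hκ'⟩ := h
  ⟨hK, norm_pow_le_of_eq_conj_diagonal hQ hF hL hκ hκ'⟩

end Stability

/-! ### Blocks of a parameter vector -/

section Blocks

variable {H du dx : ℕ}

theorem block_add (M N : Param H du dx) (i : Fin H) : block (M + N) i = block M i + block N i := rfl

theorem block_smul (r : ℝ) (M : Param H du dx) (i : Fin H) : block (r • M) i = r • block M i := rfl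

theorem norm_sq_eq_sum_block (M : Param H du dx) :
    ‖M‖ ^ 2 = ∑ i : Fin H, ∑ a, ∑ b, block M i a b ^ 2 := by
  simp only [EuclideanSpace.norm_sq_eq, Fintype.sum_prod_type, Real.norm_eq_abs, sq_abs, block,
    Matrix.of_apply]

theorem norm_app_block_le (M : Param H du dx) (i : Fin H) (x : Vec dx) :
    ‖app (block M i) x‖ ≤ ‖M‖ * ‖x‖ := by
  refine abs_le_of_sq_le_sq' ?_ (by positivity) |>.2
  calc ‖app (block M i) x‖ ^ 2
      = ∑ a, (∑ b, block M i a b * x b) ^ 2 := by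
        simp only [EuclideanSpace.norm_sq_eq, Real.norm_eq_abs, sq_abs, app_apply]
    _ ≤ ∑ a, (∑ b, block M i a b ^ 2) * ‖x‖ ^ 2 := by
        simp only [EuclideanSpace.norm_sq_eq, Real.norm_eq_abs, sq_abs]
        exact Finset.sum_le_sum fun a _ => Finset.sum_mul_sq_le_sq_mul_sq _ _ _
    _ = (∑ a, ∑ b, block M i a b ^ 2) * ‖x‖ ^ 2 := by rw [Finset.sum_mul]
    _ ≤ ‖M‖ ^ 2 * ‖x‖ ^ 2 := by
        rw [norm_sq_eq_sum_block]
        gcongr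
        exact Finset.single_le_sum (f := fun i => ∑ a, ∑ b, block M i a b ^ 2)
          (fun j _ => by positivity) (Finset.mem_univ i)
    _ = (‖M‖ * ‖x‖) ^ 2 := (mul_pow _ _ _).symm

theorem convex_feasible {κ κB γ : ℝ} : Convex ℝ (feasible H du dx κ κB γ) := by
  intro M hM N hN a b ha hb hab i
  exact mem_closedBall_zero_iff.1 (convex_closedBall 0 _ (mem_closedBall_zero_iff.2 (hM i))
    (mem_closedBall_zero_iff.2 (hN i)) ha hb hab)

end Blocks

/-! ### Strong convexity -/

section StrongConvexity

variable {F : Type*} [NormedAddCommGroup F] [NormedSpace ℝ F] {φ : F → ℝ} {α : ℝ}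

theorem strongConvexOn_add_fderiv_le (hφ : StrongConvexOn Set.univ α φ) {x : F} {φ' : F →L[ℝ] ℝ}
    (hd : HasFDerivAt φ φ' x) (y : F) : φ x + φ' (y - x) + α / 2 * ‖y - x‖ ^ 2 ≤ φ y := by
  have hslope : Filter.Tendsto (fun t : ℝ => t⁻¹ • (φ (x + t • (y - x)) - φ x))
      (nhdsWithin 0 (Set.Ioi 0)) (nhds (φ' (y - x))) := by
    simpa using HasDerivAt.tendsto_slope_zero_right (hd.hasLineDerivAt (y - x))
  have hbound : Filter.Tendsto (fun t : ℝ => φ y - φ x - (1 - t) * (α / 2 * ‖y - x‖ ^ 2))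
      (nhdsWithin 0 (Set.Ioi 0)) (nhds (φ y - φ x - (1 - 0) * (α / 2 * ‖y - x‖ ^ 2))) :=
    Filter.Tendsto.mono_left (Continuous.tendsto (by fun_prop) 0) nhdsWithin_le_nhds
  have hle : φ' (y - x) ≤ φ y - φ x - (1 - 0) * (α / 2 * ‖y - x‖ ^ 2) := by
    refine le_of_tendsto_of_tendsto hslope hbound ?_
    filter_upwards [Ioo_mem_nhdsGT one_pos] with t ht
    have h := hφ.2 (Set.mem_univ x) (Set.mem_univ y) (sub_nonneg.2 ht.2.le) ht.1.le
      (sub_add_cancel 1 t)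
    have hline : (1 - t) • x + t • y = x + t • (y - x) := by module
    rw [hline, norm_sub_rev] at h
    rw [smul_eq_mul, inv_mul_le_iff₀ ht.1]
    simp only [smul_eq_mul] at h
    linarith
  linarith

theorem mul_norm_sub_le_norm_sub_of_strongConvexOn (hφ : StrongConvexOn Set.univ α φ) {x y : F}
    {φx φy : F →L[ℝ] ℝ} (hx : HasFDerivAt φ φx x) (hy : HasFDerivAt φ φy y) :
    α * ‖x - y‖ ≤ ‖φx - φy‖ := by
  rcases eq_or_ne x y with rfl | hne
  · simp
  have hpos : 0 < ‖x - y‖ := norm_sub_pos_iff.2 hne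
  have hxy := strongConvexOn_add_fderiv_le hφ hx y
  have hyx := strongConvexOn_add_fderiv_le hφ hy x
  have hmono : α * ‖x - y‖ ^ 2 ≤ (φx - φy) (x - y) := by
    rw [← neg_sub x y, map_neg, norm_neg] at hxy
    rw [sub_apply]
    linarith
  have hnorm := (le_abs_self _).trans ((φx - φy).le_opNorm (x - y))
  exact le_of_mul_le_mul_right (by nlinarith) hpos

end StrongConvexity

/-! ### Expectations of convex functions of a random affine map -/

theorem sq_integral_le_integral_sq {Ω : Type*} [MeasurableSpace Ω] {ν : Measure Ω}
    [IsProbabilityMeasure ν] {f : Ω → ℝ} (hf : Integrable f ν)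
    (hf2 : Integrable (fun x => f x ^ 2) ν) :
    (∫ x, f x ∂ν) ^ 2 ≤ ∫ x, f x ^ 2 ∂ν :=
  even_two.convexOn_pow.map_integral_le (continuous_pow 2).continuousOn isClosed_univ
    (Filter.Eventually.of_forall fun _ => Set.mem_univ _) hf hf2

section RandomAffine

variable {X E F : Type*} [NormedAddCommGroup X] [ProperSpace X] [MeasurableSpace X] [BorelSpace X]
  {ν : Measure X} {W : ℝ}

theorem integrable_of_ae_norm_le [IsFiniteMeasure ν] [NormedAddCommGroup E]
    (hν : ∀ᵐ x ∂ν, ‖x‖ ≤ W) {f : X → E} (hf : Continuous f) : Integrable f ν := by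
  obtain ⟨C, hC⟩ := (isCompact_closedBall (0 : X) W).exists_bound_of_continuousOn hf.continuousOn
  refine Integrable.of_bound hf.aestronglyMeasurable C ?_
  filter_upwards [hν] with x hx
  exact hC x (mem_closedBall_zero_iff.2 hx)

variable [NormedAddCommGroup E] [NormedSpace ℝ E] [FiniteDimensional ℝ E]
  [NormedAddCommGroup F] [NormedSpace ℝ F] [FiniteDimensional ℝ F]
  {z₀ : X → F} {J : X → E →L[ℝ] F} {φ : F → ℝ} {α : ℝ}

theorem integrable_fderiv_and_hasFDerivAt_integral_comp_affine [IsFiniteMeasure ν]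
    (hν : ∀ᵐ x ∂ν, ‖x‖ ≤ W) (hz₀ : Continuous z₀) (hJ : Continuous J)
    (hφ : Differentiable ℝ φ) (hconv : ConvexOn ℝ Set.univ φ) (M : E) :
    Integrable (fun x => (fderiv ℝ φ (z₀ x + J x M)).comp (J x)) ν ∧
    HasFDerivAt (fun M => ∫ x, φ (z₀ x + J x M) ∂ν)
      (∫ x, (fderiv ℝ φ (z₀ x + J x M)).comp (J x) ∂ν) M := by
  have : ProperSpace E := FiniteDimensional.proper ℝ E
  have : ProperSpace (F →L[ℝ] ℝ) := FiniteDimensional.proper ℝ _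
  borelize F
  have hz : Continuous fun p : X × E => z₀ p.1 + J p.1 p.2 := by fun_prop
  obtain ⟨C, hC⟩ := (hconv.locallyLipschitz.locallyLipschitzOn
    (s := (fun p : X × E => z₀ p.1 + J p.1 p.2) ''
      Metric.closedBall 0 W ×ˢ Metric.closedBall M 1)).exists_lipschitzOnWith_of_compact
    (((isCompact_closedBall 0 W).prod (isCompact_closedBall M 1)).image hz)
  have hcont (N : E) : Continuous fun x => φ (z₀ x + J x N) :=
    hφ.continuous.comp (by fun_prop)
  refine hasFDerivAt_integral_of_dominated_loc_of_lip'
    (bound := fun x => C * ‖J x‖) (Metric.ball_mem_nhds M one_pos)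
    (fun N _ => (hcont N).aestronglyMeasurable) (integrable_of_ae_norm_le hν (hcont M)) ?_ ?_
    (integrable_of_ae_norm_le hν (by fun_prop)) ?_
  · have hmeas : Measurable fun x => fderiv ℝ φ (z₀ x + J x M) :=
      (measurable_fderiv ℝ φ).comp (by fun_prop : Continuous fun x => z₀ x + J x M).measurable
    exact (continuous_fst.clm_comp continuous_snd : Continuous
      fun p : (F →L[ℝ] ℝ) × (E →L[ℝ] F) => p.1.comp p.2).comp_aestronglyMeasurable
        (hmeas.aestronglyMeasurable.prodMk hJ.aestronglyMeasurable)
  · filter_upwards [hν] with x hx N hN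
    have hmem {N' : E} (hN' : N' ∈ Metric.closedBall M 1) :=
      Set.mem_image_of_mem (fun p : X × E => z₀ p.1 + J p.1 p.2)
        (Set.mk_mem_prod (mem_closedBall_zero_iff.2 hx) hN')
    calc ‖φ (z₀ x + J x N) - φ (z₀ x + J x M)‖
        ≤ C * ‖z₀ x + J x N - (z₀ x + J x M)‖ := hC.norm_sub_le
          (hmem (Metric.ball_subset_closedBall hN)) (hmem (Metric.mem_closedBall_self zero_le_one))
      _ = C * ‖J x (N - M)‖ := by rw [add_sub_add_left_eq_sub, map_sub]
      _ ≤ C * (‖J x‖ * ‖N - M‖) := by gcongr; exact (J x).le_opNorm _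
      _ = C * ‖J x‖ * ‖N - M‖ := (mul_assoc _ _ _).symm
  · exact Filter.Eventually.of_forall fun x =>
      (hφ _).hasFDerivAt.comp M ((J x).hasFDerivAt.const_add _)

theorem integral_comp_affine_sub_le [IsFiniteMeasure ν] (hν : ∀ᵐ x ∂ν, ‖x‖ ≤ W)
    (hz₀ : Continuous z₀) (hJ : Continuous J) (hφ : Differentiable ℝ φ)
    (hα : 0 ≤ α) (hconv : StrongConvexOn Set.univ α φ) (M N : E) :
    ∫ x, φ (z₀ x + J x M) ∂ν - ∫ x, φ (z₀ x + J x N) ∂ν ≤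
      fderiv ℝ (fun M => ∫ x, φ (z₀ x + J x M) ∂ν) M (M - N) -
        α / 2 * ∫ x, ‖J x (M - N)‖ ^ 2 ∂ν := by
  obtain ⟨hdint, hderiv⟩ := integrable_fderiv_and_hasFDerivAt_integral_comp_affine hν hz₀ hJ hφ
    (hconv.convexOn fun r => by positivity) M
  have hintφ (M : E) : Integrable (fun x => φ (z₀ x + J x M)) ν :=
    integrable_of_ae_norm_le hν (hφ.continuous.comp (by fun_prop))
  have hintsq : Integrable (fun x => ‖J x (M - N)‖ ^ 2) ν :=
    integrable_of_ae_norm_le hν (by fun_prop)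
  rw [hderiv.fderiv, ContinuousLinearMap.integral_apply hdint, ← integral_sub (hintφ M) (hintφ N),
    ← integral_const_mul, ← integral_sub (hdint.apply_continuousLinearMap _) (hintsq.const_mul _)]
  refine integral_mono ((hintφ M).sub (hintφ N))
    ((hdint.apply_continuousLinearMap _).sub (hintsq.const_mul _)) fun x => ?_
  have hle := strongConvexOn_add_fderiv_le hconv (hφ (z₀ x + J x M)).hasFDerivAt (z₀ x + J x N)
  rw [add_sub_add_left_eq_sub, ← map_sub, ← neg_sub M N, map_neg, map_neg, norm_neg] at hle
  simp only [ContinuousLinearMap.comp_apply]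
  linarith

theorem sq_fderiv_integral_comp_affine_le [IsProbabilityMeasure ν] (hν : ∀ᵐ x ∂ν, ‖x‖ ≤ W)
    (hz₀ : Continuous z₀) (hJ : Continuous J) (hφ : Differentiable ℝ φ)
    (hconv : ConvexOn ℝ Set.univ φ) {M : E} {Γ : ℝ}
    (hΓ : ∀ᵐ x ∂ν, ‖fderiv ℝ φ (z₀ x + J x M)‖ ≤ Γ) (N : E) :
    fderiv ℝ (fun M => ∫ x, φ (z₀ x + J x M) ∂ν) M N ^ 2 ≤ Γ ^ 2 * ∫ x, ‖J x N‖ ^ 2 ∂ν := by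
  obtain ⟨hdint, hderiv⟩ :=
    integrable_fderiv_and_hasFDerivAt_integral_comp_affine hν hz₀ hJ hφ hconv M
  have hintJ : Integrable (fun x => ‖J x N‖) ν := integrable_of_ae_norm_le hν (by fun_prop)
  have habs : |∫ x, (fderiv ℝ φ (z₀ x + J x M)).comp (J x) N ∂ν| ≤ Γ * ∫ x, ‖J x N‖ ∂ν := by
    rw [← integral_const_mul, ← Real.norm_eq_abs]
    refine norm_integral_le_of_norm_le (hintJ.const_mul Γ) ?_
    filter_upwards [hΓ] with x hx
    exact ((fderiv ℝ φ (z₀ x + J x M)).le_opNorm (J x N)).trans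
      (mul_le_mul_of_nonneg_right hx (norm_nonneg _))
  rw [hderiv.fderiv, ContinuousLinearMap.integral_apply hdint, ← sq_abs]
  calc _ ≤ (Γ * ∫ x, ‖J x N‖ ∂ν) ^ 2 := pow_le_pow_left₀ (abs_nonneg _) habs 2
    _ = Γ ^ 2 * (∫ x, ‖J x N‖ ∂ν) ^ 2 := mul_pow _ _ _
    _ ≤ Γ ^ 2 * ∫ x, ‖J x N‖ ^ 2 ∂ν := by
      gcongr
      exact sq_integral_le_integral_sq hintJ (integrable_of_ae_norm_le hν (by fun_prop))

end RandomAffine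

/-! ### Quadratic forms -/

section QuadraticForm

variable {ι : Type*} [Fintype ι] {P : Matrix ι ι ℝ}

theorem sqNorm_add (hP : P.IsHermitian) (a b : EuclideanSpace ℝ ι) :
    sqNorm P (a + b) = sqNorm P a + 2 * (a.ofLp ⬝ᵥ (P *ᵥ b.ofLp)) + sqNorm P b := by
  have hsymm : b.ofLp ⬝ᵥ (P *ᵥ a.ofLp) = a.ofLp ⬝ᵥ (P *ᵥ b.ofLp) := by
    rw [Matrix.dotProduct_mulVec, ← Matrix.mulVec_transpose, dotProduct_comm,
      ← Matrix.conjTranspose_eq_transpose_of_trivial, hP.eq]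
  simp only [sqNorm, WithLp.ofLp_add, Matrix.mulVec_add, dotProduct_add, add_dotProduct, hsymm]
  ring

theorem sqNorm_smul (r : ℝ) (a : EuclideanSpace ℝ ι) : sqNorm P (r • a) = r ^ 2 * sqNorm P a := by
  simp only [sqNorm, WithLp.ofLp_smul, Matrix.mulVec_smul, dotProduct_smul, smul_dotProduct,
    smul_eq_mul]
  ring

theorem sqNorm_neg (a : EuclideanSpace ℝ ι) : sqNorm P (-a) = sqNorm P a := by
  rw [← neg_one_smul ℝ a, sqNorm_smul, neg_one_sq, one_mul]

theorem sqNorm_sub_comm (a b : EuclideanSpace ℝ ι) : sqNorm P (a - b) = sqNorm P (b - a) := by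
  rw [← neg_sub, sqNorm_neg]

theorem sqNorm_nonneg (hP : P.PosSemidef) (a : EuclideanSpace ℝ ι) : 0 ≤ sqNorm P a :=
  hP.dotProduct_mulVec_nonneg a.ofLp

theorem dotProduct_ofLp (x y : EuclideanSpace ℝ ι) : x.ofLp ⬝ᵥ y.ofLp = inner ℝ x y := by
  rw [EuclideanSpace.inner_eq_star_dotProduct, star_trivial, dotProduct_comm]

theorem sqNorm_integral {Ω : Type*} [MeasurableSpace Ω] {ν : Measure Ω} {S : Ω → Matrix ι ι ℝ}
    (hS : ∀ p q, Integrable (fun x => S x p q) ν) (m : EuclideanSpace ℝ ι) :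
    sqNorm (Matrix.of fun p q => ∫ x, S x p q ∂ν) m = ∫ x, sqNorm (S x) m ∂ν := by
  have hterm (p q) : Integrable (fun x => m p * (S x p q * m q)) ν :=
    ((hS p q).mul_const _).const_mul _
  simp only [sqNorm, dotProduct, Matrix.mulVec, Finset.mul_sum, Matrix.of_apply]
  rw [integral_finsetSum _ fun p _ => integrable_finsetSum _ fun q _ => hterm p q]
  refine Finset.sum_congr rfl fun p _ => ?_
  rw [integral_finsetSum _ fun q _ => hterm p q]
  simp only [integral_const_mul, integral_mul_const]

theorem posDef_of_mul_norm_sq_le (hP : P.IsHermitian) {r : ℝ} (hr : 0 < r)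
    (h : ∀ m, r * ‖m‖ ^ 2 ≤ sqNorm P m) : P.PosDef := by
  refine .of_dotProduct_mulVec_pos hP fun x hx => ?_
  have hpos : 0 < ‖(WithLp.toLp 2 x : EuclideanSpace ℝ ι)‖ := norm_pos_iff.2 (by simpa using hx)
  exact (by positivity : 0 < r * ‖(WithLp.toLp 2 x : EuclideanSpace ℝ ι)‖ ^ 2).trans_le (h _)

variable [DecidableEq ι]

theorem sqNorm_sub_smul_one (r : ℝ) (m : EuclideanSpace ℝ ι) :
    sqNorm (P - r • (1 : Matrix ι ι ℝ)) m = sqNorm P m - r * ‖m‖ ^ 2 := by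
  rw [sqNorm, sqNorm, Matrix.sub_mulVec, dotProduct_sub, Matrix.smul_mulVec, Matrix.one_mulVec,
    dotProduct_smul, dotProduct_ofLp m m, real_inner_self_eq_norm_sq, smul_eq_mul]

theorem posSemidef_sub_smul_one (hP : P.IsHermitian) {r : ℝ}
    (h : ∀ m, r * ‖m‖ ^ 2 ≤ sqNorm P m) : (P - r • (1 : Matrix ι ι ℝ)).PosSemidef := by
  have hr : (r • (1 : Matrix ι ι ℝ)).IsHermitian := by
    rw [Matrix.IsHermitian, Matrix.conjTranspose_smul, Matrix.conjTranspose_one, star_trivial]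
  refine .of_dotProduct_mulVec_nonneg (hP.sub hr) fun x => ?_
  exact (sub_nonneg.2 (h (WithLp.toLp 2 x))).trans_eq (sqNorm_sub_smul_one r _).symm

end QuadraticForm

/-! ### Projected preconditioned gradient descent -/

section Descent

variable {ι : Type*} [Fintype ι] {P : Matrix ι ι ℝ} {S : Set (EuclideanSpace ℝ ι)}
  {Y N Z : EuclideanSpace ℝ ι}

theorem IsProj.dotProduct_nonneg (hP : P.IsHermitian) (hS : Convex ℝ S) (h : IsProj P S Y N)
    (hZ : Z ∈ S) : 0 ≤ (N - Y).ofLp ⬝ᵥ (P *ᵥ (Z - N).ofLp) := by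
  obtain ⟨hN, hmin⟩ := h
  set b := (N - Y).ofLp ⬝ᵥ (P *ᵥ (Z - N).ofLp) with hb
  have hsegment : ∀ t ∈ Set.Ioo (0 : ℝ) 1, 0 ≤ 2 * b + t * sqNorm P (Z - N) := by
    intro t ht
    have hle := hmin _ (hS.add_smul_sub_mem hN hZ ⟨ht.1.le, ht.2.le⟩)
    rw [add_sub_right_comm, sqNorm_add hP, sqNorm_smul, WithLp.ofLp_smul, Matrix.mulVec_smul,
      dotProduct_smul, smul_eq_mul, ← hb] at hle
    exact nonneg_of_mul_nonneg_right (by linarith : 0 ≤ t * (2 * b + t * sqNorm P (Z - N))) ht.1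
  have hlim : Filter.Tendsto (fun t : ℝ => 2 * b + t * sqNorm P (Z - N))
      (nhdsWithin 0 (Set.Ioi 0)) (nhds (2 * b + 0 * sqNorm P (Z - N))) :=
    (Continuous.tendsto (by fun_prop) 0).mono_left nhdsWithin_le_nhds
  have := ge_of_tendsto hlim (Filter.mem_of_superset (Ioo_mem_nhdsGT one_pos) hsegment)
  linarith

theorem IsProj.sqNorm_sub_le (hP : P.PosSemidef) (hS : Convex ℝ S) (h : IsProj P S Y N)
    (hZ : Z ∈ S) : sqNorm P (N - Z) ≤ sqNorm P (Y - Z) := by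
  have hexpand := sqNorm_add hP.isHermitian (N - Y) (Z - N)
  rw [sub_add_sub_cancel', sqNorm_sub_comm Z Y, sqNorm_sub_comm Z N] at hexpand
  have := h.dotProduct_nonneg hP.isHermitian hS hZ
  have := sqNorm_nonneg hP (N - Y)
  linarith

theorem sum_le_of_strongly_convex_descent {α s Γ : ℝ} (hα : 0 < α) (hs : 1 ≤ s) {T : ℕ}
    {δ p a b : ℕ → ℝ} (ha : ∀ t, 0 ≤ a t) (hb : ∀ t, 0 ≤ b t)
    (hδ : ∀ t ∈ Finset.Icc 1 T, δ t ≤ p t - α / 2 * a t)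
    (hstep : ∀ t ∈ Finset.Icc 1 T,
      b t ≤ a t - 2 * (s / (α * t)) * p t + (s / (α * t)) ^ 2 * Γ ^ 2)
    (hab : ∀ t, 1 ≤ t → t < T → a (t + 1) ≤ b t) :
    ∑ t ∈ Finset.Icc 1 T, δ t ≤ s / (2 * α) * Γ ^ 2 * ∑ t ∈ Finset.Icc 1 T, (1 / t : ℝ) := by
  have : 0 < s := one_pos.trans_le hs
  suffices key : ∀ τ ≤ T, ∑ t ∈ Finset.Icc 1 τ, δ t + α * τ / (2 * s) * b τ ≤
      s / (2 * α) * Γ ^ 2 * ∑ t ∈ Finset.Icc 1 τ, (1 / t : ℝ) by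
    have := mul_nonneg (by positivity : 0 ≤ α * T / (2 * s)) (hb T)
    linarith [key T le_rfl]
  intro τ
  induction τ with
  | zero => simp
  | succ τ ih =>
    intro hτ
    have hmem : τ + 1 ∈ Finset.Icc 1 T := Finset.mem_Icc.2 ⟨by omega, hτ⟩
    have hpos : (0 : ℝ) < ((τ + 1 : ℕ) : ℝ) := by positivity
    have hdescent : α * ((τ + 1 : ℕ) : ℝ) / (2 * s) * b (τ + 1) ≤
        α * ((τ + 1 : ℕ) : ℝ) / (2 * s) * a (τ + 1) - p (τ + 1) +
          s / (2 * α) * Γ ^ 2 * (1 / ((τ + 1 : ℕ) : ℝ)) := by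
      refine (mul_le_mul_of_nonneg_left (hstep _ hmem) (by positivity)).trans (le_of_eq ?_)
      field_simp
    have hcoef : α * ((τ + 1 : ℕ) : ℝ) / (2 * s) - α / 2 ≤ α * τ / (2 * s) := by
      rw [div_sub_div _ _ (by positivity) two_ne_zero, div_le_div_iff₀ (by positivity)
        (by positivity)]
      have : 0 ≤ α * s * (s - 1) := mul_nonneg (by positivity) (sub_nonneg.2 hs)
      push_cast
      nlinarith
    have hcontract := mul_le_mul_of_nonneg_right hcoef (ha (τ + 1))
    have hcarry : α * τ / (2 * s) * a (τ + 1) ≤ α * τ / (2 * s) * b τ := by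
      rcases τ.eq_zero_or_pos with rfl | hτ0
      · simp
      · exact mul_le_mul_of_nonneg_left (hab τ hτ0 hτ) (by positivity)
    rw [Finset.sum_Icc_succ_top (by omega), Finset.sum_Icc_succ_top (by omega), mul_add]
    linarith [ih (by omega), hδ _ hmem]

variable [DecidableEq ι]

theorem mulVec_inv_mulVec (hP : P.PosDef) (g : ι → ℝ) : P *ᵥ (P⁻¹ *ᵥ g) = g := by
  rw [Matrix.mulVec_mulVec, Matrix.mul_nonsing_inv P ((Matrix.isUnit_iff_isUnit_det P).1 hP.isUnit),
    Matrix.one_mulVec]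

theorem sqNorm_sub_smul_inv_mulVec (hP : P.PosDef) (x g : EuclideanSpace ℝ ι) (η : ℝ) :
    sqNorm P (x - η • WithLp.toLp 2 (P⁻¹ *ᵥ g.ofLp)) = sqNorm P x - 2 * η * inner ℝ g x +
      η ^ 2 * sqNorm P (WithLp.toLp 2 (P⁻¹ *ᵥ g.ofLp)) := by
  rw [sub_eq_add_neg, ← neg_smul, sqNorm_add hP.isHermitian, sqNorm_smul, WithLp.ofLp_smul,
    Matrix.mulVec_smul, mulVec_inv_mulVec hP, dotProduct_smul, dotProduct_ofLp, real_inner_comm,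
    smul_eq_mul]
  ring

theorem sqNorm_inv_mulVec_le (hP : P.PosDef) {g : EuclideanSpace ℝ ι} {Γ : ℝ}
    (hg : ∀ N, inner ℝ g N ^ 2 ≤ Γ ^ 2 * sqNorm P N) :
    sqNorm P (WithLp.toLp 2 (P⁻¹ *ᵥ g.ofLp)) ≤ Γ ^ 2 := by
  set v : EuclideanSpace ℝ ι := WithLp.toLp 2 (P⁻¹ *ᵥ g.ofLp) with hv
  have hself : sqNorm P v = inner ℝ g v := by
    rw [sqNorm, hv, mulVec_inv_mulVec hP, ← hv, dotProduct_ofLp, real_inner_comm]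
  rcases (sqNorm_nonneg hP.posSemidef v).eq_or_lt with h0 | hpos
  · exact h0 ▸ sq_nonneg Γ
  · have := hg v
    rw [← hself, sq] at this
    exact le_of_mul_le_mul_right this hpos

theorem sqNorm_sub_le_of_isProj_step (hP : P.PosDef) (hS : Convex ℝ S)
    {x x' g : EuclideanSpace ℝ ι} {η Γ : ℝ} (hx : x ∈ S)
    (hproj : IsProj P S (x - η • WithLp.toLp 2 (P⁻¹ *ᵥ g.ofLp)) x')
    (hg : ∀ N, inner ℝ g N ^ 2 ≤ Γ ^ 2 * sqNorm P N) : sqNorm P (x' - x) ≤ η ^ 2 * Γ ^ 2 := by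
  refine (hproj.sqNorm_sub_le hP.posSemidef hS hx).trans ?_
  rw [sub_right_comm, sub_self, zero_sub, sqNorm_neg, sqNorm_smul]
  exact mul_le_mul_of_nonneg_left (sqNorm_inv_mulVec_le hP hg) (sq_nonneg η)

theorem sum_le_of_isProj_step (hP : P.PosDef) (hS : Convex ℝ S) {α s Γ : ℝ} (hα : 0 < α)
    (hs : 1 ≤ s) {T : ℕ} {δ : ℕ → ℝ} {x g : ℕ → EuclideanSpace ℝ ι} (hZ : Z ∈ S)
    (hproj : ∀ t, 1 ≤ t → t < T →
      IsProj P S (x t - (s / (α * t)) • WithLp.toLp 2 (P⁻¹ *ᵥ (g t).ofLp)) (x (t + 1)))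
    (hδ : ∀ t ∈ Finset.Icc 1 T, δ t ≤ inner ℝ (g t) (x t - Z) - α / 2 * sqNorm P (x t - Z))
    (hg : ∀ t ∈ Finset.Icc 1 T, ∀ N, inner ℝ (g t) N ^ 2 ≤ Γ ^ 2 * sqNorm P N) :
    ∑ t ∈ Finset.Icc 1 T, δ t ≤ s / (2 * α) * Γ ^ 2 * ∑ t ∈ Finset.Icc 1 T, (1 / t : ℝ) := by
  refine sum_le_of_strongly_convex_descent hα hs (fun t => sqNorm_nonneg hP.posSemidef (x t - Z))
    (b := fun t => sqNorm P (x t - (s / (α * t)) • WithLp.toLp 2 (P⁻¹ *ᵥ (g t).ofLp) - Z))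
    (fun t => sqNorm_nonneg hP.posSemidef _) hδ (fun t ht => ?_)
    fun t h1 hT => (hproj t h1 hT).sqNorm_sub_le hP.posSemidef hS hZ
  rw [sub_right_comm, sqNorm_sub_smul_inv_mulVec hP]
  gcongr
  exact sqNorm_inv_mulVec_le hP (hg t ht)

end Descent

/-! ### The surrogate system in terms of lagged noise -/

section Surrogate

variable {H du dx : ℕ}

/-- The disturbance action `∑ i, M^{[i]} v i` of the lagged noise `v`, as a linear map in `M`. -/
noncomputable def perturbation (v : ℕ → Vec dx) : Param H du dx →ₗ[ℝ] Vec du where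
  toFun M := ∑ i : Fin H, app (block M i) (v i)
  map_add' M N := by simp only [block_add, app_add_left, Finset.sum_add_distrib]
  map_smul' r M := by
    simp only [block_smul, app, map_smul, LinearMap.smul_apply, Finset.smul_sum, RingHom.id_apply]

theorem perturbation_apply (v : ℕ → Vec dx) (M : Param H du dx) :
    perturbation v M = ∑ i : Fin H, app (block M i) (v i) := rfl

/-- The noise of a window of length `2 * H`, read backwards from its end and extended by zero. -/
def lag (w : Fin (2 * H) → Vec dx) (k : ℕ) : Vec dx :=
  if h : k < 2 * H then w (Fin.rev ⟨k, h⟩) else 0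

theorem lag_of_lt (w : Fin (2 * H) → Vec dx) {k : ℕ} (hk : k < 2 * H) :
    lag w k = w (Fin.rev ⟨k, hk⟩) :=
  dif_pos hk

theorem lag_of_le (w : Fin (2 * H) → Vec dx) {k : ℕ} (hk : 2 * H ≤ k) : lag w k = 0 :=
  dif_neg (not_lt.2 hk)

theorem continuous_lag (k : ℕ) : Continuous fun w : Fin (2 * H) → Vec dx => lag w k := by
  unfold lag
  split_ifs
  · exact continuous_apply _
  · exact continuous_const

theorem continuous_perturbation_lag (j : ℕ) (M : Param H du dx) :
    Continuous fun w : Fin (2 * H) → Vec dx => perturbation (fun i => lag w (j + i)) M := by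
  simp only [perturbation_apply]
  exact continuous_finsetSum _ fun i _ => (continuous_app _).comp (continuous_lag _)

theorem sum_range_app_ite_pow (F : Matrix (Fin dx) (Fin dx) ℝ) {v : ℕ → Vec dx} {N : ℕ}
    (hv : ∀ k, N ≤ k → v k = 0) :
    ∑ k ∈ Finset.range N, app (if k ≤ H then F ^ k else 0) (v k) =
      ∑ k ∈ Finset.range (H + 1), app (F ^ k) (v k) := by
  have hpow : ∑ k ∈ Finset.range (H + 1), app (F ^ k) (v k) =
      ∑ k ∈ Finset.range (H + 1), app (if k ≤ H then F ^ k else 0) (v k) :=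
    Finset.sum_congr rfl fun k hk => by rw [if_pos (Finset.mem_range_succ_iff.1 hk)]
  rw [hpow, Finset.sum_subset (Finset.range_mono (Nat.le_add_right N (H + 1))),
    Finset.sum_subset (Finset.range_mono (Nat.le_add_left (H + 1) N))]
  · intro k _ hk
    rw [if_neg (by simpa using hk)]
    simp [app]
  · intro k _ hk
    rw [hv k (by simpa using hk), app_zero]

theorem sum_range_app_dite_block {n : ℕ} (C : Matrix (Fin n) (Fin du) ℝ) (M : Param H du dx)
    {v : ℕ → Vec dx} {N : ℕ} (hv : ∀ k, N ≤ k → v k = 0) (j : ℕ) :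
    ∑ k ∈ Finset.range N,
        app (if h : j < k ∧ k - j ≤ H then C * block M ⟨k - j - 1, by omega⟩ else 0) (v k) =
      app C (perturbation (fun i => v (j + 1 + i)) M) := by
  have hlags : app C (perturbation (fun i => v (j + 1 + i)) M) =
      ∑ k ∈ Finset.Ico (j + 1) (j + 1 + H),
        app (if h : j < k ∧ k - j ≤ H then C * block M ⟨k - j - 1, by omega⟩ else 0) (v k) := by
    rw [Finset.sum_Ico_eq_sum_range, Nat.add_sub_cancel_left, Finset.sum_range, perturbation_apply,
      app_sum]
    refine Finset.sum_congr rfl fun i _ => ?_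
    rw [dif_pos (by omega), app_mul]
    congr 3
    ext
    simp only
    omega
  have hIco : Finset.Ico (j + 1) (j + 1 + H) ⊆ Finset.range (N + (j + 1 + H)) := fun k hk => by
    rw [Finset.mem_Ico] at hk
    exact Finset.mem_range.2 (by omega)
  rw [hlags, Finset.sum_subset (Finset.range_mono (Nat.le_add_right N (j + 1 + H))),
    Finset.sum_subset hIco]
  · intro k _ hk
    rw [dif_neg (by rw [Finset.mem_Ico] at hk; omega)]
    simp [app]
  · intro k _ hk
    rw [hv k (by simpa using hk), app_zero]

variable (A : Matrix (Fin dx) (Fin dx) ℝ) (B : Matrix (Fin dx) (Fin du) ℝ)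
  (K : Matrix (Fin du) (Fin dx) ℝ)

theorem surrogateState_eq_sum_lag (M : Param H du dx) (w : Fin (2 * H) → Vec dx) :
    surrogateState A B K M w = ∑ j ∈ Finset.range (H + 1),
      app ((A - B * K) ^ j) (lag w j + app B (perturbation (fun i => lag w (j + 1 + i)) M)) := by
  have htransfer (k : ℕ) : app (transfer A B K M k) (lag w k) =
      app (if k ≤ H then (A - B * K) ^ k else 0) (lag w k) +
        ∑ j ∈ Finset.range (H + 1), app (if h : j < k ∧ k - j ≤ H then
          (A - B * K) ^ j * B * block M ⟨k - j - 1, by omega⟩ else 0) (lag w k) := by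
    simp only [transfer, app_add_left, app, map_sum, LinearMap.sum_apply]
  calc surrogateState A B K M w
      = ∑ k ∈ Finset.range (2 * H), app (transfer A B K M k) (lag w k) := by
        simp [surrogateState, Finset.sum_range, lag_of_lt]
    _ = _ := by
        simp only [htransfer, Finset.sum_add_distrib, app_add]
        rw [Finset.sum_comm (s := Finset.range (2 * H)),
          sum_range_app_ite_pow _ fun _ => lag_of_le w]
        simp only [sum_range_app_dite_block _ M fun _ => lag_of_le w, app_mul]

theorem surrogateAction_eq_perturbation_lag (M : Param H du dx) (w : Fin (2 * H) → Vec dx) :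
    surrogateAction A B K M w = -app K (surrogateState A B K M w) + perturbation (lag w) M := by
  rw [surrogateAction, perturbation_apply]
  congr 1
  refine Finset.sum_congr rfl fun i _ => ?_
  rw [lag_of_lt w (by omega)]
  congr 2

/-- The pair `z(M) = (y(M), v(M))` as a point of a Euclidean space. -/
noncomputable def surrogate (M : Param H du dx) (w : Fin (2 * H) → Vec dx) :
    WithLp 2 (Vec dx × Vec du) :=
  WithLp.toLp 2 (surrogateState A B K M w, surrogateAction A B K M w)

/-- The linear part of the affine map `M ↦ y(M)`. -/
noncomputable def stateResponse (w : Fin (2 * H) → Vec dx) : Param H du dx →ₗ[ℝ] Vec dx :=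
  ∑ j ∈ Finset.range (H + 1),
    (Matrix.toEuclideanLin ((A - B * K) ^ j * B)).comp (perturbation fun i => lag w (j + 1 + i))

/-- The linear part of the affine map `M ↦ z(M)`. -/
noncomputable def response (w : Fin (2 * H) → Vec dx) :
    Param H du dx →L[ℝ] WithLp 2 (Vec dx × Vec du) :=
  (WithLp.prodContinuousLinearEquiv 2 ℝ (Vec dx) (Vec du)).symm.toContinuousLinearMap.comp
    (LinearMap.toContinuousLinearMap ((stateResponse A B K w).prod
      (perturbation (lag w) - Matrix.toEuclideanLin K ∘ₗ stateResponse A B K w)))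

theorem surrogateState_eq_add_stateResponse (M : Param H du dx) (w : Fin (2 * H) → Vec dx) :
    surrogateState A B K M w = surrogateState A B K 0 w + stateResponse A B K w M := by
  simp only [surrogateState_eq_sum_lag, stateResponse, LinearMap.sum_apply, LinearMap.comp_apply,
    map_zero, add_zero, app_add, Finset.sum_add_distrib, app_mul]

theorem surrogate_eq_add_response (M : Param H du dx) (w : Fin (2 * H) → Vec dx) :
    surrogate A B K M w = surrogate A B K 0 w + response A B K w M := by
  have hresponse : response A B K w M = WithLp.toLp 2 (stateResponse A B K w M,
      perturbation (lag w) M - app K (stateResponse A B K w M)) := rfl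
  rw [surrogate, surrogate, hresponse, ← WithLp.toLp_add, Prod.mk_add_mk,
    surrogateAction_eq_perturbation_lag, surrogateAction_eq_perturbation_lag A B K 0,
    surrogateState_eq_add_stateResponse, app_add, map_zero]
  congr 2
  abel

theorem app_fst_response_add_snd_response (w : Fin (2 * H) → Vec dx) (M : Param H du dx) :
    app K (response A B K w M).fst + (response A B K w M).snd = perturbation (lag w) M :=
  add_sub_cancel _ _

theorem continuous_surrogate (M : Param H du dx) : Continuous (surrogate A B K M) := by
  have hstate : Continuous (surrogateState A B K M) := by
    simp only [funext (surrogateState_eq_sum_lag A B K M)]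
    exact continuous_finsetSum _ fun j _ => (continuous_app _).comp ((continuous_lag j).add
      ((continuous_app B).comp (continuous_perturbation_lag _ M)))
  have haction : Continuous (surrogateAction A B K M) := by
    simp only [funext (surrogateAction_eq_perturbation_lag A B K M)]
    have := continuous_perturbation_lag 0 M
    simp only [zero_add] at this
    exact ((continuous_app K).comp hstate).neg.add this
  exact (WithLp.prod_continuous_toLp 2 _ _).comp (hstate.prodMk haction)

theorem continuous_response :
    Continuous (response A B K : (Fin (2 * H) → Vec dx) → Param H du dx →L[ℝ] _) := by
  refine continuous_clm_apply.2 fun M => ?_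
  simp only [← sub_eq_of_eq_add' (surrogate_eq_add_response A B K M _)]
  exact (continuous_surrogate A B K M).sub (continuous_surrogate A B K 0)

end Surrogate

/-! ### The noise -/

section Noise

variable {dx du H : ℕ} {μ : Measure (Vec dx)} {σ W : ℝ}

theorem NoiseLaw.bound_nonneg (h : NoiseLaw μ σ W) : 0 ≤ W := by
  have := h.prob
  obtain ⟨x, hx⟩ := h.bounded.exists
  exact (norm_nonneg x).trans hx

theorem NoiseLaw.ae_pi_norm_le (h : NoiseLaw μ σ W) {ι : Type*} [Fintype ι] :
    ∀ᵐ w ∂(Measure.pi fun _ : ι => μ), ‖w‖ ≤ W := by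
  have := h.prob
  simp only [pi_norm_le_iff_of_nonneg h.bound_nonneg, ae_all_iff]
  exact fun i => (Measure.quasiMeasurePreserving_eval (fun _ : ι => μ) i).ae h.bounded

theorem NoiseLaw.ae_norm_le (h : NoiseLaw μ σ W) {Ω : Type*} [MeasurableSpace Ω] {P : Measure Ω}
    {X : Ω → Vec dx} (hX : HasLaw X μ P) : ∀ᵐ ω ∂P, ‖X ω‖ ≤ W :=
  ae_of_ae_map hX.aemeasurable (hX.map_eq ▸ h.bounded)

theorem NoiseLaw.integral_inner_eq_zero (h : NoiseLaw μ σ W) (x : Vec dx) :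
    ∫ w, inner ℝ x w ∂μ = 0 := by
  have := h.prob
  rw [integral_inner (f := fun w : Vec dx => w)
    (integrable_of_ae_norm_le h.bounded continuous_id) x, h.mean_zero, inner_zero_right]

theorem NoiseLaw.mul_norm_sq_le_integral_inner_sq (h : NoiseLaw μ σ W) (x : Vec dx) :
    σ ^ 2 * ‖x‖ ^ 2 ≤ ∫ w, inner ℝ x w ^ 2 ∂μ := by
  have := h.prob
  have houter (w : Vec dx) : sqNorm (Matrix.vecMulVec w.ofLp w.ofLp) x = inner ℝ x w ^ 2 := by
    rw [sqNorm, Matrix.vecMulVec_mulVec, dotProduct_smul, dotProduct_ofLp, dotProduct_ofLp,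
      real_inner_comm, sq]
    rfl
  have hmoment : sqNorm (secondMoment μ) x = ∫ w, inner ℝ x w ^ 2 ∂μ := by
    simp only [← houter]
    refine sqNorm_integral (fun a b => integrable_of_ae_norm_le h.bounded ?_) x
    fun_prop
  rw [← hmoment, ← sub_nonneg, ← sqNorm_sub_smul_one]
  exact sqNorm_nonneg h.cov x

theorem NoiseLaw.le_bound (h : NoiseLaw μ σ W) (hdx : 0 < dx) : σ ≤ W := by
  have := h.prob
  let e : Vec dx := EuclideanSpace.single ⟨0, hdx⟩ 1
  have he : ‖e‖ = 1 := by simp [e]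
  refine le_of_sq_le_sq ?_ h.bound_nonneg
  calc σ ^ 2 = σ ^ 2 * ‖e‖ ^ 2 := by rw [he, one_pow, mul_one]
    _ ≤ ∫ w, inner ℝ e w ^ 2 ∂μ := h.mul_norm_sq_le_integral_inner_sq e
    _ ≤ ∫ _, W ^ 2 ∂μ := by
      refine integral_mono_ae (integrable_of_ae_norm_le h.bounded (by fun_prop))
        (integrable_const _) ?_
      filter_upwards [h.bounded] with w hw
      have hinner := abs_real_inner_le_norm e w
      rw [he, one_mul] at hinner
      exact sq_le_sq.2 ((hinner.trans hw).trans (le_abs_self W))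
    _ = W ^ 2 := by simp

theorem NoiseLaw.sum_norm_sq_le_integral_sum_inner_sq (h : NoiseLaw μ σ W) {Ω : Type*}
    [MeasurableSpace Ω] {P : Measure Ω} {ι : Type*} [Fintype ι] {X : ι → Ω → Vec dx}
    (hX : ∀ i, HasLaw (X i) μ P) (hind : iIndepFun X P) (r : ι → Vec dx) :
    σ ^ 2 * ∑ i, ‖r i‖ ^ 2 ≤ ∫ ω, (∑ i, inner ℝ (r i) (X i ω)) ^ 2 ∂P := by
  have := h.prob
  have := hind.isProbabilityMeasure
  have hmem (i : ι) : MemLp (fun ω => inner ℝ (r i) (X i ω)) 2 P := by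
    refine MemLp.of_bound (((hX i).aemeasurable.const_inner (c := r i)).aestronglyMeasurable)
      (‖r i‖ * W) ?_
    filter_upwards [h.ae_norm_le (hX i)] with ω hω
    exact (norm_inner_le_norm _ _).trans (mul_le_mul_of_nonneg_left hω (norm_nonneg _))
  have hmean (i : ι) : ∫ ω, inner ℝ (r i) (X i ω) ∂P = 0 :=
    ((hX i).integral_comp (f := fun x => inner ℝ (r i) x) (by fun_prop)).trans
      (h.integral_inner_eq_zero (r i))
  have hvar (i : ι) :
      variance (fun ω => inner ℝ (r i) (X i ω)) P = ∫ x, inner ℝ (r i) x ^ 2 ∂μ := by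
    rw [variance_of_integral_eq_zero (hmem i).aemeasurable (hmean i)]
    exact (hX i).integral_comp (f := fun x => inner ℝ (r i) x ^ 2) (by fun_prop)
  calc σ ^ 2 * ∑ i, ‖r i‖ ^ 2
      ≤ ∑ i, ∫ x, inner ℝ (r i) x ^ 2 ∂μ := by
        rw [Finset.mul_sum]
        exact Finset.sum_le_sum fun i _ => h.mul_norm_sq_le_integral_inner_sq (r i)
    _ = variance (∑ i, fun ω => inner ℝ (r i) (X i ω)) P := by
        rw [IndepFun.variance_sum fun i _ => hmem i]
        · simp only [hvar]
        · intro i _ j _ hij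
          exact (hind.indepFun hij).comp (φ := fun x => inner ℝ (r i) x)
            (ψ := fun x => inner ℝ (r j) x) (by fun_prop) (by fun_prop)
    _ = ∫ ω, (∑ i, inner ℝ (r i) (X i ω)) ^ 2 ∂P := by
        rw [variance_of_integral_eq_zero]
        · simp only [Finset.sum_apply]
        · exact Finset.aemeasurable_sum _ fun i _ => (hmem i).aemeasurable
        · simp only [Finset.sum_apply]
          rw [integral_finsetSum _ fun i _ => (hmem i).integrable one_le_two]
          exact Finset.sum_eq_zero fun i _ => hmean i

theorem NoiseLaw.mul_norm_sq_le_integral_perturbation (h : NoiseLaw μ σ W) (M : Param H du dx) :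
    σ ^ 2 * ‖M‖ ^ 2 ≤
      ∫ w, ‖perturbation (lag w) M‖ ^ 2 ∂(Measure.pi fun _ : Fin (2 * H) => μ) := by
  have := h.prob
  let ρ (i : Fin H) : Fin (2 * H) := Fin.rev ⟨i, by omega⟩
  have hρ : Function.Injective ρ := fun i j hij => by
    simpa [Fin.ext_iff] using Fin.rev_injective hij
  let row (a : Fin du) (i : Fin H) : Vec dx := WithLp.toLp 2 (block M i a)
  have hlaw (i : Fin H) : HasLaw (fun w : Fin (2 * H) → Vec dx => w (ρ i)) μ
      (Measure.pi fun _ : Fin (2 * H) => μ) :=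
    (measurePreserving_eval (fun _ : Fin (2 * H) => μ) (ρ i)).hasLaw
  have hind : iIndepFun (fun i (w : Fin (2 * H) → Vec dx) => w (ρ i))
      (Measure.pi fun _ : Fin (2 * H) => μ) :=
    (iIndepFun_pi (X := fun _ x => x) fun _ => aemeasurable_id).precomp hρ
  have hnorm (w : Fin (2 * H) → Vec dx) :
      ‖perturbation (lag w) M‖ ^ 2 = ∑ a, (∑ i, inner ℝ (row a i) (w (ρ i))) ^ 2 := by
    rw [EuclideanSpace.real_norm_sq_eq]
    refine Finset.sum_congr rfl fun a _ => ?_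
    rw [perturbation_apply, WithLp.ofLp_sum, Finset.sum_apply]
    congr 1
    refine Finset.sum_congr rfl fun i _ => ?_
    rw [lag_of_lt w (by omega : (i : ℕ) < 2 * H), app_apply, ← dotProduct_ofLp]
    rfl
  calc σ ^ 2 * ‖M‖ ^ 2 = ∑ a, σ ^ 2 * ∑ i, ‖row a i‖ ^ 2 := by
        rw [norm_sq_eq_sum_block, Finset.sum_comm, Finset.mul_sum]
        simp only [row, EuclideanSpace.real_norm_sq_eq]
    _ ≤ ∑ a, ∫ w, (∑ i, inner ℝ (row a i) (w (ρ i))) ^ 2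
          ∂(Measure.pi fun _ : Fin (2 * H) => μ) :=
        Finset.sum_le_sum fun a _ => h.sum_norm_sq_le_integral_sum_inner_sq hlaw hind (row a)
    _ = _ := by
        simp only [hnorm]
        exact (integral_finsetSum _ fun a _ =>
          integrable_of_ae_norm_le h.ae_pi_norm_le (by fun_prop)).symm

end Noise

/-! ### The preconditioner -/

section Gram

variable {dx du H : ℕ} {μ : Measure (Vec dx)} {σ W κ γ : ℝ}
  (A : Matrix (Fin dx) (Fin dx) ℝ) (B : Matrix (Fin dx) (Fin du) ℝ)
  (K : Matrix (Fin du) (Fin dx) ℝ)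

theorem jacobian_apply (w : Fin (2 * H) → Vec dx) (r : Fin dx ⊕ Fin du)
    (p : Fin H × Fin du × Fin dx) :
    jacobian A B K w r p =
      Sum.elim (response A B K w (EuclideanSpace.single p 1)).fst.ofLp
        (response A B K w (EuclideanSpace.single p 1)).snd.ofLp r := by
  have hpair (N : Param H du dx) : surrogatePair A B K N w =
      Sum.elim (surrogate A B K N w).fst.ofLp (surrogate A B K N w).snd.ofLp := rfl
  rw [jacobian, Matrix.of_apply, hpair, hpair, surrogate_eq_add_response A B K (.single p 1)]
  rcases r with r | r <;> exact add_sub_cancel_left _ _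

theorem jacobian_mulVec (w : Fin (2 * H) → Vec dx) (m : Param H du dx) :
    jacobian A B K w *ᵥ m.ofLp =
      Sum.elim (response A B K w m).fst.ofLp (response A B K w m).snd.ofLp := by
  have hm : ∑ p, m p • EuclideanSpace.single p (1 : ℝ) = m := by
    simpa using (EuclideanSpace.basisFun _ ℝ).sum_repr m
  funext r
  rcases r with r | r
  · have hfst := congr_arg (fun N => WithLp.fstₗ 2 ℝ (Vec dx) (Vec du) (response A B K w N) r) hm
    simpa [Matrix.mulVec, dotProduct, jacobian_apply, mul_comm] using hfst
  · have hsnd := congr_arg (fun N => WithLp.sndₗ 2 ℝ (Vec dx) (Vec du) (response A B K w N) r) hm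
    simpa [Matrix.mulVec, dotProduct, jacobian_apply, mul_comm] using hsnd

theorem continuous_jacobian_apply (r : Fin dx ⊕ Fin du) (p : Fin H × Fin du × Fin dx) :
    Continuous fun w : Fin (2 * H) → Vec dx => jacobian A B K w r p := by
  have hresponse := (continuous_response (H := H) A B K).clm_apply
    (continuous_const (y := EuclideanSpace.single p (1 : ℝ)))
  simp only [jacobian_apply]
  rcases r with r | r <;> simp only [Sum.elim_inl, Sum.elim_inr] <;> fun_prop

theorem sqNorm_transpose_jacobian_mul (w : Fin (2 * H) → Vec dx) (m : Param H du dx) :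
    sqNorm ((jacobian A B K w)ᵀ * jacobian A B K w) m = ‖response A B K w m‖ ^ 2 := by
  rw [sqNorm, ← Matrix.mulVec_mulVec, Matrix.dotProduct_mulVec, Matrix.vecMul_transpose,
    jacobian_mulVec, dotProduct, Fintype.sum_sum_type, WithLp.prod_norm_sq_eq_of_L2,
    EuclideanSpace.real_norm_sq_eq, EuclideanSpace.real_norm_sq_eq]
  simp only [Sum.elim_inl, Sum.elim_inr, sq]

theorem sqNorm_expectedGram (h : NoiseLaw μ σ W) (m : Param H du dx) :
    sqNorm (expectedGram H μ A B K) m =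
      ∫ w, ‖response A B K w m‖ ^ 2 ∂(Measure.pi fun _ : Fin (2 * H) => μ) := by
  have := h.prob
  simp only [← sqNorm_transpose_jacobian_mul]
  refine sqNorm_integral (fun p q => integrable_of_ae_norm_le h.ae_pi_norm_le ?_) m
  simp only [Matrix.mul_apply, Matrix.transpose_apply]
  exact continuous_finsetSum _ fun r _ =>
    (continuous_jacobian_apply A B K r p).mul (continuous_jacobian_apply A B K r q)

theorem isHermitian_expectedGram : (expectedGram H μ A B K).IsHermitian := by
  refine Matrix.IsHermitian.ext fun p q => ?_
  have hsymm (w : Fin (2 * H) → Vec dx) :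
      ((jacobian A B K w)ᵀ * jacobian A B K w)ᵀ = (jacobian A B K w)ᵀ * jacobian A B K w := by
    rw [Matrix.transpose_mul, Matrix.transpose_transpose]
  rw [star_trivial]
  exact integral_congr_ae (.of_forall fun w => congr_fun₂ (hsymm w) p q)

-- The disturbance action is a linear image of the response, and its second moment is at least
-- `σ ^ 2 * ‖m‖ ^ 2` because distinct blocks of `m` act on independent noise vectors.
theorem div_mul_norm_sq_le_sqNorm_expectedGram (h : NoiseLaw μ σ W) (hK : ‖K‖ ≤ κ)
    (m : Param H du dx) :
    σ ^ 2 / (1 + κ ^ 2) * ‖m‖ ^ 2 ≤ sqNorm (expectedGram H μ A B K) m := by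
  have := h.prob
  have hle (w : Fin (2 * H) → Vec dx) :
      ‖perturbation (lag w) m‖ ^ 2 ≤ (1 + κ ^ 2) * ‖response A B K w m‖ ^ 2 := by
    rw [← app_fst_response_add_snd_response A B K w m, WithLp.prod_norm_sq_eq_of_L2]
    set y := (response A B K w m).fst
    set v := (response A B K w m).snd
    have htriangle : ‖app K y + v‖ ≤ κ * ‖y‖ + ‖v‖ :=
      (norm_add_le _ _).trans (add_le_add_left (norm_app_le_of_le hK le_rfl) _)
    calc ‖app K y + v‖ ^ 2 ≤ (κ * ‖y‖ + ‖v‖) ^ 2 := by gcongr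
      _ ≤ (1 + κ ^ 2) * (‖y‖ ^ 2 + ‖v‖ ^ 2) := by
        linarith [sq_nonneg (κ * ‖v‖ - ‖y‖)]
  have hresponse : Continuous fun w => response A B K w m :=
    (continuous_response A B K).clm_apply continuous_const
  have hperturbation := continuous_perturbation_lag 0 m
  simp only [zero_add] at hperturbation
  rw [div_mul_eq_mul_div, div_le_iff₀ (by positivity), sqNorm_expectedGram A B K h,
    mul_comm _ (1 + κ ^ 2), ← integral_const_mul]
  exact (h.mul_norm_sq_le_integral_perturbation m).trans <| integral_mono
    (integrable_of_ae_norm_le h.ae_pi_norm_le (by fun_prop))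
    (integrable_of_ae_norm_le h.ae_pi_norm_le (by fun_prop)) hle

theorem posDef_expectedGram (h : NoiseLaw μ σ W) (hσ : 0 < σ) :
    (expectedGram H μ A B K).PosDef :=
  posDef_of_mul_norm_sq_le (isHermitian_expectedGram A B K) (by positivity)
    (div_mul_norm_sq_le_sqNorm_expectedGram A B K h le_rfl)

theorem posSemidef_expectedGram_sub (h : NoiseLaw μ σ W) (hκ : 1 ≤ κ) (hγ : 0 ≤ γ) (hγ1 : γ ≤ 1)
    (hK : ‖K‖ ≤ κ) :
    (expectedGram H μ A B K - (γ ^ 2 * σ ^ 2 / (36 * κ ^ 10)) •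
      (1 : Matrix (Fin H × Fin du × Fin dx) (Fin H × Fin du × Fin dx) ℝ)).PosSemidef := by
  refine posSemidef_sub_smul_one (isHermitian_expectedGram A B K) fun m =>
    le_trans ?_ (div_mul_norm_sq_le_sqNorm_expectedGram A B K h hK m)
  have hγsq : γ ^ 2 * σ ^ 2 ≤ σ ^ 2 :=
    mul_le_of_le_one_left (sq_nonneg σ) (pow_le_one₀ hγ hγ1)
  have hκpow : 1 + κ ^ 2 ≤ 36 * κ ^ 10 := by
    have := pow_le_pow_right₀ hκ (show 2 ≤ 10 by norm_num)
    have := one_le_pow₀ hκ (n := 10)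
    linarith
  gcongr

end Gram

/-! ### Cost functions -/

section Cost

variable {dx du : ℕ} {c : Vec dx → Vec du → ℝ} {α G W D : ℝ}

/-- A cost `c` as a function on the Euclidean space of pairs `(x, u)`. -/
def pairCost (c : Vec dx → Vec du → ℝ) (z : WithLp 2 (Vec dx × Vec du)) : ℝ := c z.fst z.snd

theorem CostCondition.differentiable_pairCost (h : CostCondition c α G W) :
    Differentiable ℝ (pairCost c) :=
  h.differentiable.comp (WithLp.prodContinuousLinearEquiv 2 ℝ (Vec dx) (Vec du)).differentiable

theorem CostCondition.differentiable_left (h : CostCondition c α G W) (u : Vec du) :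
    Differentiable ℝ fun x => c x u :=
  h.differentiable.comp (differentiable_id.prodMk (differentiable_const u))

theorem CostCondition.differentiable_right (h : CostCondition c α G W) (x : Vec dx) :
    Differentiable ℝ fun u => c x u :=
  h.differentiable.comp ((differentiable_const x).prodMk differentiable_id)

theorem norm_gradient {E : Type*} [NormedAddCommGroup E] [InnerProductSpace ℝ E] [CompleteSpace E]
    (f : E → ℝ) (x : E) : ‖gradient f x‖ = ‖fderiv ℝ f x‖ :=
  LinearIsometryEquiv.norm_map _ _

theorem CostCondition.slope_nonneg (h : CostCondition c α G W) (hW : W ≤ D) (hD : 0 ≤ D) :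
    0 ≤ G * D :=
  (norm_nonneg _).trans (h.grad_bound D hW 0 0 (by simpa) (by simpa)).1

theorem CostCondition.fderiv_pairCost_apply (h : CostCondition c α G W)
    (z v : WithLp 2 (Vec dx × Vec du)) :
    fderiv ℝ (pairCost c) z v =
      inner ℝ (gradient (fun x => c x z.snd) z.fst) v.fst +
        inner ℝ (gradient (fun u => c z.fst u) z.snd) v.snd := by
  let F : Vec dx × Vec du → ℝ := fun p => c p.1 p.2
  let L := fderiv ℝ F (z.fst, z.snd)
  have hF : HasFDerivAt F L (z.fst, z.snd) := (h.differentiable _).hasFDerivAt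
  have hx : HasFDerivAt (fun x => c x z.snd) (L.comp (.inl ℝ _ _)) z.fst :=
    hF.comp (f := fun x => (x, z.snd)) z.fst (hasFDerivAt_prodMk_left z.fst z.snd)
  have hu : HasFDerivAt (fun u => c z.fst u) (L.comp (.inr ℝ _ _)) z.snd :=
    hF.comp (f := fun u => (z.fst, u)) z.snd (hasFDerivAt_prodMk_right z.fst z.snd)
  have hz : fderiv ℝ (pairCost c) z =
      L.comp (WithLp.prodContinuousLinearEquiv 2 ℝ (Vec dx) (Vec du) : _ →L[ℝ] _) :=
    (WithLp.prodContinuousLinearEquiv 2 ℝ (Vec dx) (Vec du)).comp_right_fderiv (f := F) (x := z)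
  rw [inner_gradient_left, inner_gradient_left, hx.fderiv, hu.fderiv, hz]
  calc L (v.fst, v.snd) = L ((v.fst, 0) + (0, v.snd)) := by simp
    _ = L (v.fst, 0) + L (0, v.snd) := map_add L _ _

theorem CostCondition.norm_fderiv_pairCost_le (h : CostCondition c α G W) (hD : W ≤ D)
    {z : WithLp 2 (Vec dx × Vec du)} (hx : ‖z.fst‖ ≤ D) (hu : ‖z.snd‖ ≤ D) :
    ‖fderiv ℝ (pairCost c) z‖ ≤ 2 * (G * D) := by
  obtain ⟨hgx, hgu⟩ := h.grad_bound D hD z.fst z.snd hx hu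
  have hGD := h.slope_nonneg hD ((norm_nonneg _).trans hx)
  refine ContinuousLinearMap.opNorm_le_bound _ (by positivity) fun v => ?_
  calc ‖fderiv ℝ (pairCost c) z v‖
      ≤ ‖gradient (fun x => c x z.snd) z.fst‖ * ‖v.fst‖ +
          ‖gradient (fun u => c z.fst u) z.snd‖ * ‖v.snd‖ := by
        rw [h.fderiv_pairCost_apply]
        exact (norm_add_le (E := ℝ) _ _).trans (add_le_add (norm_inner_le_norm _ _)
          (norm_inner_le_norm _ _))
    _ ≤ G * D * ‖v‖ + G * D * ‖v‖ := by
      gcongr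
      exacts [WithLp.norm_fst_le _ v, WithLp.norm_snd_le _ v]
    _ = 2 * (G * D) * ‖v‖ := by ring

theorem CostCondition.abs_sub_le (h : CostCondition c α G W) (hD : W ≤ D)
    {x x' : Vec dx} {u u' : Vec du} (hx : ‖x‖ ≤ D) (hu : ‖u‖ ≤ D) (hx' : ‖x'‖ ≤ D)
    (hu' : ‖u'‖ ≤ D) : |c x u - c x' u'| ≤ G * D * (‖x - x'‖ + ‖u - u'‖) := by
  have hstate : |c x u - c x' u| ≤ G * D * ‖x - x'‖ :=
    (convex_closedBall (0 : Vec dx) D).norm_image_sub_le_of_norm_fderiv_le (𝕜 := ℝ)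
      (fun y _ => h.differentiable_left u y)
      (fun y hy => (norm_gradient _ y).symm.trans_le
        (h.grad_bound D hD y u (mem_closedBall_zero_iff.1 hy) hu).1)
      (mem_closedBall_zero_iff.2 hx') (mem_closedBall_zero_iff.2 hx)
  have haction : |c x' u - c x' u'| ≤ G * D * ‖u - u'‖ :=
    (convex_closedBall (0 : Vec du) D).norm_image_sub_le_of_norm_fderiv_le (𝕜 := ℝ)
      (fun v _ => h.differentiable_right x' v)
      (fun v hv => (norm_gradient _ v).symm.trans_le
        (h.grad_bound D hD x' v hx' (mem_closedBall_zero_iff.1 hv)).2)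
      (mem_closedBall_zero_iff.2 hu') (mem_closedBall_zero_iff.2 hu)
  rw [mul_add]
  exact (_root_.abs_sub_le _ _ _).trans (add_le_add hstate haction)

-- Strong convexity moves the gradient by at least `α * W` over the distance `W`, whereas the
-- gradient stays below `2 * (G * W)`.
theorem CostCondition.convexity_le_slope (h : CostCondition c α G W) (hW : 0 < W) (hdx : 0 < dx) :
    α ≤ 4 * G := by
  let z : WithLp 2 (Vec dx × Vec du) :=
    WithLp.toLp 2 (EuclideanSpace.single ⟨0, hdx⟩ W, 0)
  have hz : ‖z.fst‖ = W := by simp [z, abs_of_pos hW]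
  have hz' : ‖z.snd‖ ≤ W := by simp [z, hW.le]
  have hbound : α * W ≤ 2 * (G * W) + 2 * (G * W) :=
    calc α * W = α * ‖z - 0‖ := by
          simp [z, abs_of_pos hW]
      _ ≤ ‖fderiv ℝ (pairCost c) z - fderiv ℝ (pairCost c) 0‖ :=
          mul_norm_sub_le_norm_sub_of_strongConvexOn h.strongConvex
            (h.differentiable_pairCost z).hasFDerivAt (h.differentiable_pairCost 0).hasFDerivAt
      _ ≤ 2 * (G * W) + 2 * (G * W) :=
          (norm_sub_le _ _).trans (add_le_add (h.norm_fderiv_pairCost_le le_rfl hz.le hz')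
            (h.norm_fderiv_pairCost_le le_rfl (by simpa using hW.le) (by simpa using hW.le)))
  exact le_of_mul_le_mul_right (hbound.trans_eq (by ring)) hW

end Cost

/-! ### The surrogate cost -/

section SurrogateCost

variable {dx du H : ℕ} {μ : Measure (Vec dx)} {σ W α G D : ℝ} {c : Vec dx → Vec du → ℝ}
  (A : Matrix (Fin dx) (Fin dx) ℝ) (B : Matrix (Fin dx) (Fin du) ℝ)
  (K : Matrix (Fin du) (Fin dx) ℝ)

theorem surrogateCost_eq_integral_comp_affine :
    (surrogateCost μ A B K c : Param H du dx → ℝ) = fun M =>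
      ∫ w, pairCost c (surrogate A B K 0 w + response A B K w M)
        ∂(Measure.pi fun _ : Fin (2 * H) => μ) := by
  funext M
  simp only [← surrogate_eq_add_response]
  rfl

theorem surrogateCost_sub_le (h : NoiseLaw μ σ W) (hc : CostCondition c α G W) (hα : 0 ≤ α)
    (M N : Param H du dx) :
    surrogateCost μ A B K c M - surrogateCost μ A B K c N ≤
      inner ℝ (gradient (surrogateCost μ A B K c) M) (M - N) -
        α / 2 * sqNorm (expectedGram H μ A B K) (M - N) := by
  have := h.prob
  rw [inner_gradient_left, sqNorm_expectedGram A B K h, surrogateCost_eq_integral_comp_affine]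
  exact integral_comp_affine_sub_le h.ae_pi_norm_le (continuous_surrogate A B K 0)
    (continuous_response A B K) hc.differentiable_pairCost hα hc.strongConvex M N

theorem sq_inner_gradient_surrogateCost_le (h : NoiseLaw μ σ W) (hc : CostCondition c α G W)
    (hα : 0 ≤ α) (hD : W ≤ D) {M : Param H du dx}
    (hM : ∀ w, ‖w‖ ≤ W → ‖surrogateState A B K M w‖ ≤ D ∧ ‖surrogateAction A B K M w‖ ≤ D)
    (N : Param H du dx) :
    inner ℝ (gradient (surrogateCost μ A B K c) M) N ^ 2 ≤
      (2 * (G * D)) ^ 2 * sqNorm (expectedGram H μ A B K) N := by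
  have := h.prob
  rw [inner_gradient_left, sqNorm_expectedGram A B K h, surrogateCost_eq_integral_comp_affine]
  refine sq_fderiv_integral_comp_affine_le h.ae_pi_norm_le (continuous_surrogate A B K 0)
    (continuous_response A B K) hc.differentiable_pairCost
    (hc.strongConvex.convexOn fun r => by positivity) ?_ N
  filter_upwards [h.ae_pi_norm_le] with w hw
  rw [← surrogate_eq_add_response]
  exact hc.norm_fderiv_pairCost_le hD (hM w hw).1 (hM w hw).2

end SurrogateCost

/-! ### Trajectories of a stable closed loop -/

theorem sum_geometric_le {γ : ℝ} (hγ : 0 < γ) (hγ1 : γ < 1) (n : ℕ) :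
    ∑ j ∈ Finset.range n, (1 - γ) ^ j ≤ γ⁻¹ := by
  have h := Summable.sum_le_tsum (Finset.range n)
    (fun j _ => pow_nonneg (sub_nonneg.2 hγ1.le) j)
    (summable_geometric_of_lt_one (sub_nonneg.2 hγ1.le) (sub_lt_self 1 hγ))
  rwa [tsum_geometric_of_lt_one (sub_nonneg.2 hγ1.le) (sub_lt_self 1 hγ), sub_sub_cancel] at h

/-- Power stability of the gain `K` with all problem parameters (`γ⁻¹`, `‖B‖`, `‖K‖` and the
stability constant) absorbed in the single constant `β`, so that the error terms are monomials
in `β`. -/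
structure StableRegime {dx du : ℕ} (A : Matrix (Fin dx) (Fin dx) ℝ)
    (B : Matrix (Fin dx) (Fin du) ℝ) (β γ : ℝ) (K : Matrix (Fin du) (Fin dx) ℝ) : Prop
    extends PowerStable A B β γ K where
  gamma_pos : 0 < γ
  gamma_lt_one : γ < 1
  inv_gamma_le : γ⁻¹ ≤ β
  norm_input_le : ‖B‖ ≤ β

section StableRegime

variable {dx du H : ℕ} {A : Matrix (Fin dx) (Fin dx) ℝ} {B : Matrix (Fin dx) (Fin du) ℝ}
  {K : Matrix (Fin du) (Fin dx) ℝ} {β γ W R : ℝ}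

theorem StableRegime.one_le (hK : StableRegime A B β γ K) : 1 ≤ β :=
  ((one_le_inv₀ hK.gamma_pos).2 hK.gamma_lt_one.le).trans hK.inv_gamma_le

theorem StableRegime.pow_mul_le_pow_mul (hK : StableRegime A B β γ K) {m n : ℕ} (hmn : m ≤ n)
    (hW : 0 ≤ W) : β ^ m * W ≤ β ^ n * W :=
  mul_le_mul_of_nonneg_right (pow_le_pow_right₀ hK.one_le hmn) hW

theorem StableRegime.rate_pow_nonneg (hK : StableRegime A B β γ K) (n : ℕ) : 0 ≤ (1 - γ) ^ n :=
  pow_nonneg (sub_nonneg.2 hK.gamma_lt_one.le) n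

theorem StableRegime.rate_pow_succ_le (hK : StableRegime A B β γ K) (n : ℕ) :
    (1 - γ) ^ (n + 1) ≤ (1 - γ) ^ n :=
  pow_le_pow_of_le_one (sub_nonneg.2 hK.gamma_lt_one.le) (sub_le_self 1 hK.gamma_pos.le)
    n.le_succ

theorem StableRegime.sum_rate_pow_le (hK : StableRegime A B β γ K) (n : ℕ) :
    ∑ j ∈ Finset.range n, (1 - γ) ^ j ≤ β :=
  (sum_geometric_le hK.gamma_pos hK.gamma_lt_one n).trans hK.inv_gamma_le

theorem feasible_subset_feasible {κ κB κ' κB' : ℝ} (hκ : 0 ≤ κ) (hκB : 0 ≤ κB) (hγ : γ ≤ 1)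
    (hκκ' : κ ≤ κ') (hκBκB' : κB ≤ κB') : feasible H du dx κ κB γ ⊆ feasible H du dx κ' κB' γ := by
  intro M hM i
  have : 0 ≤ 1 - γ := sub_nonneg.2 hγ
  have : 0 ≤ κ' := hκ.trans hκκ'
  exact (hM i).trans (by gcongr)

theorem StableRegime.norm_sum_pow_app_le (hK : StableRegime A B β γ K) {v : ℕ → Vec dx} {k : ℕ}
    (hR : 0 ≤ R) (hv : ∀ j < k, ‖v j‖ ≤ R) :
    ‖∑ j ∈ Finset.range k, app ((A - B * K) ^ j) (v j)‖ ≤ β ^ 3 * R := by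
  calc ‖∑ j ∈ Finset.range k, app ((A - B * K) ^ j) (v j)‖
      ≤ ∑ j ∈ Finset.range k, β ^ 2 * (1 - γ) ^ j * R :=
        norm_sum_le_of_le _ fun j hj =>
          norm_app_le_of_le (hK.norm_pow_le j) (hv j (Finset.mem_range.1 hj))
    _ = β ^ 2 * R * ∑ j ∈ Finset.range k, (1 - γ) ^ j := by
        rw [Finset.mul_sum]
        exact Finset.sum_congr rfl fun j _ => by ring
    _ ≤ β ^ 2 * R * β := by
        have := hK.sum_rate_pow_le k
        gcongr
    _ = β ^ 3 * R := by ring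

theorem eq_app_pow_add_sum {n : ℕ} {F : Matrix (Fin n) (Fin n) ℝ} {x r : ℕ → Vec n}
    (hx : ∀ t, 1 ≤ t → x (t + 1) = app F (x t) + r t) {t : ℕ} (ht : 1 ≤ t) (k : ℕ) :
    x (t + k) = app (F ^ k) (x t) + ∑ j ∈ Finset.range k, app (F ^ j) (r (t + k - 1 - j)) := by
  induction k with
  | zero => simp only [add_zero, pow_zero, app_one, Finset.range_zero, Finset.sum_empty]
  | succ k ih =>
    rw [← add_assoc, hx _ (by omega), ih, app_add, ← app_mul, ← pow_succ', app_sum,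
      Finset.sum_range_succ' _ k, pow_zero, app_one, add_assoc]
    congr 2
    refine Finset.sum_congr rfl fun j _ => ?_
    rw [← app_mul, ← pow_succ']
    congr 2
    omega

theorem StableRegime.norm_le_of_recurrence (hK : StableRegime A B β γ K) {x r : ℕ → Vec dx}
    (hx₁ : x 1 = 0) (hx : ∀ t, 1 ≤ t → x (t + 1) = app (A - B * K) (x t) + r t) (hR : 0 ≤ R)
    {t : ℕ} (ht : 1 ≤ t) (hr : ∀ s, 1 ≤ s → s < t → ‖r s‖ ≤ R) : ‖x t‖ ≤ β ^ 3 * R := by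
  obtain ⟨k, rfl⟩ := Nat.exists_eq_add_of_le ht
  rw [eq_app_pow_add_sum hx le_rfl, hx₁, app_zero, zero_add]
  exact hK.norm_sum_pow_app_le hR fun j hj => hr _ (by omega) (by omega)

theorem StableRegime.norm_add_app_le (hK : StableRegime A B β γ K) {q : Vec du} {v : Vec dx}
    (hq : ‖q‖ ≤ β ^ 5 * W) (hv : ‖v‖ ≤ W) : ‖v + app B q‖ ≤ 2 * β ^ 6 * W := by
  have hW := (norm_nonneg v).trans hv
  calc ‖v + app B q‖ ≤ ‖v‖ + ‖app B q‖ := norm_add_le _ _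
    _ ≤ β ^ 6 * W + β * (β ^ 5 * W) := by
        refine add_le_add (hv.trans ?_) (norm_app_le_of_le hK.norm_input_le hq)
        exact le_mul_of_one_le_left hW (one_le_pow₀ hK.one_le)
    _ = 2 * β ^ 6 * W := by ring

theorem StableRegime.norm_neg_app_add_le (hK : StableRegime A B β γ K) (hW : 0 ≤ W) {x : Vec dx}
    {q : Vec du} (hx : ‖x‖ ≤ 2 * β ^ 9 * W) (hq : ‖q‖ ≤ β ^ 5 * W) :
    ‖-app K x + q‖ ≤ 3 * β ^ 10 * W := by
  calc ‖-app K x + q‖ ≤ ‖app K x‖ + ‖q‖ := by simpa using norm_add_le (-app K x) q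
    _ ≤ β * (2 * β ^ 9 * W) + β ^ 10 * W :=
        add_le_add (norm_app_le_of_le hK.norm_le hx)
          (hq.trans (hK.pow_mul_le_pow_mul (by norm_num) hW))
    _ = 3 * β ^ 10 * W := by ring

theorem StableRegime.two_mul_pow_mul_le (hK : StableRegime A B β γ K) (hW : 0 ≤ W) :
    2 * β ^ 9 * W ≤ 3 * β ^ 10 * W := by
  have := hK.one_le
  gcongr <;> norm_num

theorem norm_perturbation_le_mul (M : Param H du dx) {v : ℕ → Vec dx} (hv : ∀ k, ‖v k‖ ≤ W) :
    ‖perturbation v M‖ ≤ H * (‖M‖ * W) := by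
  rw [perturbation_apply]
  calc ‖∑ i : Fin H, app (block M i) (v i)‖ ≤ ∑ _i : Fin H, ‖M‖ * W :=
        norm_sum_le_of_le _ fun i _ => (norm_app_block_le M i _).trans
          (mul_le_mul_of_nonneg_left (hv _) (norm_nonneg _))
    _ = H * (‖M‖ * W) := by simp

theorem StableRegime.norm_perturbation_le (hK : StableRegime A B β γ K) {M : Param H du dx}
    (hM : M ∈ feasible H du dx β β γ) {v : ℕ → Vec dx} (hv : ∀ k, ‖v k‖ ≤ W) :
    ‖perturbation v M‖ ≤ β ^ 5 * W := by
  have hβ := hK.one_le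
  have hW := (norm_nonneg _).trans (hv 0)
  rw [perturbation_apply]
  calc ‖∑ i : Fin H, app (block M i) (v i)‖
      ≤ ∑ i : Fin H, β ^ 3 * β * (1 - γ) ^ (i : ℕ) * W :=
        norm_sum_le_of_le _ fun i _ => norm_app_le_of_le ((hM i).trans
          (mul_le_mul_of_nonneg_left (hK.rate_pow_succ_le i) (by positivity))) (hv i)
    _ = β ^ 4 * W * ∑ i ∈ Finset.range H, (1 - γ) ^ i := by
        rw [Finset.mul_sum, Finset.sum_range]
        exact Finset.sum_congr rfl fun j _ => by ring
    _ ≤ β ^ 4 * W * β := by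
        have := hK.sum_rate_pow_le H
        gcongr
    _ = β ^ 5 * W := by ring

theorem StableRegime.norm_perturbation_sub_le (hK : StableRegime A B β γ K) {M : Param H du dx}
    (hM : M ∈ feasible H du dx β β γ) {v v' : ℕ → Vec dx} (hvv' : ∀ i, i + 1 < H → v i = v' i)
    (hW : ∀ i, ‖v i - v' i‖ ≤ W) :
    ‖perturbation v M - perturbation v' M‖ ≤ β ^ 4 * (1 - γ) ^ H * W := by
  simp only [perturbation_apply, ← Finset.sum_sub_distrib, ← app_sub]
  rcases H with _ | n
  · have := hK.one_le
    have := (norm_nonneg _).trans (hW 0)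
    simpa using by positivity
  · rw [Fin.sum_univ_castSucc, Finset.sum_eq_zero, zero_add]
    · exact norm_app_le_of_le ((hM (Fin.last n)).trans_eq (by rw [Fin.val_last]; ring)) (hW n)
    · intro i _
      rw [hvv' _ (by simp), sub_self, app_zero]

theorem norm_lag_le {w : Fin (2 * H) → Vec dx} (hw : ‖w‖ ≤ W) (k : ℕ) : ‖lag w k‖ ≤ W := by
  rcases lt_or_ge k (2 * H) with hk | hk
  · rw [lag_of_lt w hk]
    exact (norm_le_pi_norm w _).trans hw
  · rw [lag_of_le w hk, norm_zero]
    exact (norm_nonneg w).trans hw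

theorem StableRegime.norm_surrogate_le (hK : StableRegime A B β γ K) {M : Param H du dx}
    (hM : M ∈ feasible H du dx β β γ) {w : Fin (2 * H) → Vec dx} (hw : ‖w‖ ≤ W) :
    ‖surrogateState A B K M w‖ ≤ 3 * β ^ 10 * W ∧
      ‖surrogateAction A B K M w‖ ≤ 3 * β ^ 10 * W := by
  have hβ := hK.one_le
  have hW := (norm_nonneg w).trans hw
  have hstate : ‖surrogateState A B K M w‖ ≤ 2 * β ^ 9 * W := by
    rw [surrogateState_eq_sum_lag]
    refine (hK.norm_sum_pow_app_le (R := 2 * β ^ 6 * W) (by positivity) fun j _ => ?_).trans_eq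
      (by ring)
    exact hK.norm_add_app_le (hK.norm_perturbation_le hM fun _ => norm_lag_le hw _)
      (norm_lag_le hw j)
  refine ⟨hstate.trans (hK.two_mul_pow_mul_le hW), ?_⟩
  rw [surrogateAction_eq_perturbation_lag]
  exact hK.norm_neg_app_add_le hW hstate (hK.norm_perturbation_le hM (norm_lag_le hw))

end StableRegime

/-! ### Tracking the surrogate -/

section Tracking

variable {dx du H : ℕ}

/-- The noise `k + 1` steps before time `t`, with `w_s = 0` for `s ≤ 0`. -/
def pastNoise (w : ℕ → Vec dx) (t k : ℕ) : Vec dx :=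
  if k + 1 < t then w (t - (k + 1)) else 0

/-- The noise vectors `w_{t-2H}, …, w_{t-1}`, to which the surrogates at time `t` are applied. They
are only meaningful for `2 * H ≤ t`, since `t - 2 * H` is truncated at zero. -/
def window (H : ℕ) (w : ℕ → Vec dx) (t : ℕ) : Fin (2 * H) → Vec dx :=
  fun k => w (t - 2 * H + k)

theorem norm_window_le {w : ℕ → Vec dx} {W : ℝ} (hw : ∀ s, ‖w s‖ ≤ W) (t : ℕ) :
    ‖window H w t‖ ≤ W :=
  (pi_norm_le_iff_of_nonneg ((norm_nonneg _).trans (hw 0))).2 fun _ => hw _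

theorem norm_pastNoise_le {w : ℕ → Vec dx} {W : ℝ} (hw : ∀ s, ‖w s‖ ≤ W) (t k : ℕ) :
    ‖pastNoise w t k‖ ≤ W := by
  unfold pastNoise
  split_ifs
  · exact hw _
  · simpa using (norm_nonneg _).trans (hw 0)

theorem pastNoise_of_lt (w : ℕ → Vec dx) {t k : ℕ} (h : k + 1 < t) :
    pastNoise w t k = w (t - (k + 1)) :=
  if_pos h

theorem pastNoise_sub (w : ℕ → Vec dx) (t j i : ℕ) :
    pastNoise w (t - j) i = pastNoise w t (j + i) := by
  simp only [pastNoise, Nat.lt_sub_iff_add_lt, Nat.sub_sub, add_comm _ j, add_assoc]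

theorem lag_window (w : ℕ → Vec dx) {t k : ℕ} (ht : 2 * H < t) (hk : k < 2 * H) :
    lag (window H w t) k = pastNoise w t k := by
  rw [lag_of_lt _ hk, pastNoise_of_lt w (by omega), window, Fin.val_rev]
  congr 1
  simp only
  omega

theorem perturbation_congr {v v' : ℕ → Vec dx} (M : Param H du dx) (h : ∀ i < H, v i = v' i) :
    perturbation v M = perturbation v' M := by
  rw [perturbation_apply, perturbation_apply]
  exact Finset.sum_congr rfl fun i _ => by rw [h i i.isLt]

variable {A : Matrix (Fin dx) (Fin dx) ℝ} {B : Matrix (Fin dx) (Fin du) ℝ}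
  {K : Matrix (Fin du) (Fin dx) ℝ} {β γ W : ℝ} {M : Param H du dx} {w : ℕ → Vec dx}

-- The window misses at most the oldest noise vector of a delayed action, whose block is
-- exponentially small.
theorem StableRegime.norm_perturbation_pastNoise_sub_lag_le (hK : StableRegime A B β γ K)
    (hM : M ∈ feasible H du dx β β γ) (hw : ∀ s, ‖w s‖ ≤ W) {t j : ℕ} (ht : 2 * H < t)
    (hj : j ≤ H) :
    ‖perturbation (pastNoise w (t - (j + 1))) M -
        perturbation (fun i => lag (window H w t) (j + 1 + i)) M‖ ≤ β ^ 4 * (1 - γ) ^ H * W := by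
  have hlag : ∀ i, j + 1 + i < 2 * H →
      pastNoise w (t - (j + 1)) i = lag (window H w t) (j + 1 + i) := fun i hi => by
    rw [lag_window w ht hi, pastNoise_sub]
  refine hK.norm_perturbation_sub_le hM (fun i hi => hlag i (by omega)) fun i => ?_
  rcases lt_or_ge (j + 1 + i) (2 * H) with hi | hi
  · rw [hlag i hi, sub_self, norm_zero]
    exact (norm_nonneg _).trans (hw 0)
  · rw [lag_of_le _ hi, sub_zero]
    exact norm_pastNoise_le hw _ _

variable {x : ℕ → Vec dx} {q : ℕ → Vec du} {t : ℕ} {X ε : ℝ}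

theorem StableRegime.norm_sub_surrogateState_le (hK : StableRegime A B β γ K) (hH : 1 ≤ H)
    (hM : M ∈ feasible H du dx β β γ) (hw : ∀ s, ‖w s‖ ≤ W)
    (hx : ∀ t, 1 ≤ t → x (t + 1) = app (A - B * K) (x t) + (w t + app B (q t)))
    (ht : 2 * H + 2 ≤ t) (hX : ‖x (t - (H + 1))‖ ≤ X)
    (hq : ∀ s, t - (H + 1) ≤ s → s ≤ t → ‖q s - perturbation (pastNoise w s) M‖ ≤ ε) :
    ‖x t - surrogateState A B K M (window H w t)‖ ≤
      β ^ 2 * (1 - γ) ^ H * X + β ^ 4 * (ε + β ^ 4 * (1 - γ) ^ H * W) := by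
  have hβ := hK.one_le
  have hW : 0 ≤ W := (norm_nonneg _).trans (hw 0)
  have hε : 0 ≤ ε := (norm_nonneg _).trans (hq t (by omega) le_rfl)
  have hrate := hK.rate_pow_nonneg H
  have hsub : x t - surrogateState A B K M (window H w t) =
      app ((A - B * K) ^ (H + 1)) (x (t - (H + 1))) +
        ∑ j ∈ Finset.range (H + 1), app ((A - B * K) ^ j) (app B (q (t - (j + 1)) -
          perturbation (fun i => lag (window H w t) (j + 1 + i)) M)) := by
    have hunroll := eq_app_pow_add_sum hx (t := t - (H + 1)) (by omega) (H + 1)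
    rw [Nat.sub_add_cancel (by omega)] at hunroll
    rw [hunroll, surrogateState_eq_sum_lag, add_sub_assoc, ← Finset.sum_sub_distrib]
    congr 1
    refine Finset.sum_congr rfl fun j hj => ?_
    rw [Finset.mem_range] at hj
    rw [← app_sub, lag_window w (by omega) (by omega), pastNoise_of_lt w (by omega), Nat.sub_sub,
      add_comm 1 j, add_sub_add_left_eq_sub, ← app_sub]
  rw [hsub]
  refine (norm_add_le _ _).trans (add_le_add ?_ ?_)
  · exact norm_app_le_of_le ((hK.norm_pow_le _).trans (mul_le_mul_of_nonneg_left
      (hK.rate_pow_succ_le H) (by positivity))) hX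
  · refine (hK.norm_sum_pow_app_le (R := β * (ε + β ^ 4 * (1 - γ) ^ H * W)) (by positivity)
      fun j hj => norm_app_le_of_le hK.norm_input_le ?_).trans_eq (by ring)
    rw [← sub_add_sub_cancel _ (perturbation (pastNoise w (t - (j + 1))) M)]
    exact (norm_add_le _ _).trans (add_le_add (hq _ (by omega) (by omega))
      (hK.norm_perturbation_pastNoise_sub_lag_le hM hw (by omega) (by omega)))

theorem StableRegime.norm_sub_surrogateAction_le (hK : StableRegime A B β γ K)
    (ht : 2 * H < t) {S : ℝ}
    (hx : ‖x t - surrogateState A B K M (window H w t)‖ ≤ S)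
    (hq : ‖q t - perturbation (pastNoise w t) M‖ ≤ ε) :
    ‖-app K (x t) + q t - surrogateAction A B K M (window H w t)‖ ≤ β * S + ε := by
  have hlag : perturbation (lag (window H w t)) M = perturbation (pastNoise w t) M :=
    perturbation_congr M fun i hi => lag_window w ht (by omega)
  calc ‖-app K (x t) + q t - surrogateAction A B K M (window H w t)‖
      = ‖-app K (x t - surrogateState A B K M (window H w t)) +
          (q t - perturbation (pastNoise w t) M)‖ := by
        rw [surrogateAction_eq_perturbation_lag, hlag, app_sub]
        congr 1
        abel
    _ ≤ ‖app K (x t - surrogateState A B K M (window H w t))‖ +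
          ‖q t - perturbation (pastNoise w t) M‖ := (norm_add_le _ _).trans_eq (by rw [norm_neg])
    _ ≤ β * S + ε := add_le_add (norm_app_le_of_le hK.norm_le hx) hq

theorem StableRegime.norm_sub_surrogate_le (hK : StableRegime A B β γ K) (hH : 1 ≤ H)
    (hM : M ∈ feasible H du dx β β γ) (hw : ∀ s, ‖w s‖ ≤ W)
    (hx : ∀ t, 1 ≤ t → x (t + 1) = app (A - B * K) (x t) + (w t + app B (q t)))
    (ht : 2 * H + 2 ≤ t) (hX : ‖x (t - (H + 1))‖ ≤ X)
    (hq : ∀ s, t - (H + 1) ≤ s → s ≤ t → ‖q s - perturbation (pastNoise w s) M‖ ≤ ε) :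
    ‖x t - surrogateState A B K M (window H w t)‖ +
        ‖-app K (x t) + q t - surrogateAction A B K M (window H w t)‖ ≤
      3 * β ^ 5 * ((1 - γ) ^ H * X + ε + β ^ 4 * (1 - γ) ^ H * W) := by
  have hβ := hK.one_le
  have hX₀ : 0 ≤ X := (norm_nonneg _).trans hX
  have hW : 0 ≤ W := (norm_nonneg _).trans (hw 0)
  have hε : 0 ≤ ε := (norm_nonneg _).trans (hq t (by omega) le_rfl)
  have hrate := hK.rate_pow_nonneg H
  set a := (1 - γ) ^ H * X
  set b := ε + β ^ 4 * (1 - γ) ^ H * W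
  have ha : 0 ≤ a := by positivity
  have : 0 ≤ b := by positivity
  have hεb : ε ≤ b := le_add_of_nonneg_right (by positivity)
  have hstate : ‖x t - surrogateState A B K M (window H w t)‖ ≤ β ^ 4 * (a + b) := by
    calc _ ≤ β ^ 2 * (1 - γ) ^ H * X + β ^ 4 * b :=
          hK.norm_sub_surrogateState_le hH hM hw hx ht hX hq
      _ = β ^ 2 * a + β ^ 4 * b := by ring
      _ ≤ β ^ 4 * a + β ^ 4 * b := by gcongr; norm_num
      _ = β ^ 4 * (a + b) := by ring
  have haction := hK.norm_sub_surrogateAction_le (by omega) hstate (hq t (by omega) le_rfl)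
  calc _ ≤ β ^ 4 * (a + b) + (β * (β ^ 4 * (a + b)) + ε) := add_le_add hstate haction
    _ ≤ β ^ 5 * (a + b) + (β * (β ^ 4 * (a + b)) + β ^ 5 * (a + b)) := by
        gcongr ?_ * _ + (_ + ?_)
        · exact pow_le_pow_right₀ hβ (by norm_num)
        · exact (hεb.trans (le_add_of_nonneg_left ha)).trans
            (le_mul_of_one_le_left (by positivity) (one_le_pow₀ hβ))
    _ = 3 * β ^ 5 * (a + ε + β ^ 4 * (1 - γ) ^ H * W) := by ring

end Tracking

/-! ### Controllers -/

section Controllers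

variable {dx du H : ℕ} {A : Matrix (Fin dx) (Fin dx) ℝ} {B : Matrix (Fin dx) (Fin du) ℝ}
  {K K' : Matrix (Fin du) (Fin dx) ℝ} {β γ W : ℝ} {w : ℕ → Vec dx} {t : ℕ}

theorem state_succ_of_action_eq {π : ℕ → Vec dx → Vec du} {q : Vec du} (ht : 1 ≤ t)
    (hq : π t (state A B π w t) = -app K (state A B π w t) + q) :
    state A B π w (t + 1) = app (A - B * K) (state A B π w t) + (w t + app B q) := by
  obtain ⟨k, rfl⟩ := Nat.exists_eq_add_of_le' ht
  have hneg : app B (-app K (state A B π w (k + 1))) = -app (B * K) (state A B π w (k + 1)) := by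
    rw [app_mul]
    exact map_neg (Matrix.toEuclideanLin B) _
  rw [state, hq, app_add, hneg, app_sub_left]
  abel

theorem disturbanceActionController_eq (M : ℕ → Param H du dx) (w : ℕ → Vec dx) (t : ℕ)
    (x : Vec dx) : disturbanceActionController K M w t x =
      -app K x + perturbation (pastNoise w t) (M t) := by
  rw [disturbanceActionController, perturbation_apply]
  congr 1
  refine Finset.sum_congr rfl fun i _ => ?_
  rw [pastNoise]
  split_ifs
  · rfl
  · rw [app_zero]

theorem linearController_eq (K K' : Matrix (Fin du) (Fin dx) ℝ) (w : ℕ → Vec dx) (t : ℕ)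
    (x : Vec dx) : linearController K' w t x = -app K x + app (K - K') x := by
  rw [linearController, app_sub_left]
  abel

/-- The parameter of the disturbance-action controller with gain `K` that imitates the linear
controller `u = -K' x`: unrolling the closed loop of `K'` expresses `(K - K') x_t` through past
noise. -/
noncomputable def imitation (H : ℕ) (A : Matrix (Fin dx) (Fin dx) ℝ)
    (B : Matrix (Fin dx) (Fin du) ℝ) (K K' : Matrix (Fin du) (Fin dx) ℝ) : Param H du dx :=
  WithLp.toLp 2 fun p => ((K - K') * (A - B * K') ^ (p.1 : ℕ)) p.2.1 p.2.2

theorem block_imitation (K K' : Matrix (Fin du) (Fin dx) ℝ) (i : Fin H) :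
    block (imitation H A B K K') i = (K - K') * (A - B * K') ^ (i : ℕ) :=
  rfl

theorem imitation_mem_feasible {κ κB : ℝ} (hκ : 0 ≤ κ) (hγ1 : γ ≤ 1) (hκB : 2 ≤ κB * (1 - γ))
    (hK : PowerStable A B κ γ K) (hK' : PowerStable A B κ γ K') :
    imitation H A B K K' ∈ feasible H du dx κ κB γ := by
  intro i
  have : 0 ≤ 1 - γ := sub_nonneg.2 hγ1
  have hgain : ‖K - K'‖ ≤ 2 * κ :=
    (norm_sub_le_of_le hK.norm_le hK'.norm_le).trans_eq (two_mul κ).symm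
  rw [block_imitation]
  calc ‖(K - K') * (A - B * K') ^ (i : ℕ)‖ ≤ ‖K - K'‖ * ‖(A - B * K') ^ (i : ℕ)‖ :=
        Matrix.l2_opNorm_mul _ _
    _ ≤ 2 * κ * (κ ^ 2 * (1 - γ) ^ (i : ℕ)) :=
        mul_le_mul hgain (hK'.norm_pow_le i) (norm_nonneg _) (by positivity)
    _ = κ ^ 3 * (1 - γ) ^ (i : ℕ) * 2 := by ring
    _ ≤ κ ^ 3 * (1 - γ) ^ (i : ℕ) * (κB * (1 - γ)) := by gcongr
    _ = κ ^ 3 * κB * (1 - γ) ^ ((i : ℕ) + 1) := by ring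

theorem continuous_state {π : (ℕ → Vec dx) → ℕ → Vec dx → Vec du}
    (hπ : ∀ t, Continuous fun p : (ℕ → Vec dx) × Vec dx => π p.1 t p.2) :
    ∀ t, Continuous fun w : ℕ → Vec dx => state A B (π w) w t
  | 0 => continuous_const
  | 1 => continuous_const
  | t + 2 =>
    have ih := continuous_state hπ (t + 1)
    (((continuous_app A).comp ih).add ((continuous_app B).comp
      ((hπ (t + 1)).comp (continuous_id.prodMk ih)))).add (continuous_apply (t + 1))

theorem continuous_disturbanceActionController (M : ℕ → Param H du dx) (t : ℕ) :
    Continuous fun p : (ℕ → Vec dx) × Vec dx => disturbanceActionController K M p.1 t p.2 := by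
  refine ((continuous_app K).comp continuous_snd).neg.add (continuous_finsetSum _ fun i _ => ?_)
  split_ifs
  · exact (continuous_app _).comp ((continuous_apply _).comp continuous_fst)
  · exact continuous_const

theorem continuous_linearController (t : ℕ) :
    Continuous fun p : (ℕ → Vec dx) × Vec dx => linearController K p.1 t p.2 :=
  ((continuous_app K).comp continuous_snd).neg

/-- The action `u_t` that the controller `π` takes along its own trajectory. -/
noncomputable def action (A : Matrix (Fin dx) (Fin dx) ℝ) (B : Matrix (Fin dx) (Fin du) ℝ)
    (π : (ℕ → Vec dx) → ℕ → Vec dx → Vec du) (w : ℕ → Vec dx) (t : ℕ) : Vec du :=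
  π w t (state A B (π w) w t)

/-- Up to time `T` and for noise bounded by `W`, the trajectory of `π` and the surrogates of the
parameters `M_t` stay bounded by `D`, and after the `2 * H + 1` burn-in rounds they differ by at
most `b / T + d / t`. -/
structure Tracks (A : Matrix (Fin dx) (Fin dx) ℝ) (B : Matrix (Fin dx) (Fin du) ℝ)
    (K : Matrix (Fin du) (Fin dx) ℝ) (π : (ℕ → Vec dx) → ℕ → Vec dx → Vec du)
    (M : ℕ → Param H du dx) (T : ℕ) (W D b d : ℝ) : Prop where
  continuous (t : ℕ) : Continuous fun p : (ℕ → Vec dx) × Vec dx => π p.1 t p.2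
  norm_le {t : ℕ} (ht : t ∈ Finset.Icc 1 T) {w : ℕ → Vec dx} (hw : ∀ s, ‖w s‖ ≤ W) :
    ‖state A B (π w) w t‖ ≤ D ∧ ‖action A B π w t‖ ≤ D
  norm_surrogate_le {t : ℕ} (ht : t ∈ Finset.Icc 1 T) {v : Fin (2 * H) → Vec dx} (hv : ‖v‖ ≤ W) :
    ‖surrogateState A B K (M t) v‖ ≤ D ∧ ‖surrogateAction A B K (M t) v‖ ≤ D
  dist_le {t : ℕ} (ht : t ∈ Finset.Icc (2 * H + 2) T) {w : ℕ → Vec dx} (hw : ∀ s, ‖w s‖ ≤ W) :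
    ‖state A B (π w) w t - surrogateState A B K (M t) (window H w t)‖ +
      ‖action A B π w t - surrogateAction A B K (M t) (window H w t)‖ ≤ b / T + d / t

end Controllers

section DisturbanceAction

variable {dx du H T : ℕ} {A : Matrix (Fin dx) (Fin dx) ℝ} {B : Matrix (Fin dx) (Fin du) ℝ}
  {K : Matrix (Fin du) (Fin dx) ℝ} {β γ W : ℝ} {M : ℕ → Param H du dx} {w : ℕ → Vec dx} {t : ℕ}

theorem state_disturbanceActionController_succ (ht : 1 ≤ t) :
    state A B (disturbanceActionController K M w) w (t + 1) =
      app (A - B * K) (state A B (disturbanceActionController K M w) w t) +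
        (w t + app B (perturbation (pastNoise w t) (M t))) :=
  state_succ_of_action_eq ht (disturbanceActionController_eq M w t _)

theorem StableRegime.norm_state_disturbanceActionController_le (hK : StableRegime A B β γ K)
    (hM : ∀ t ∈ Finset.Icc 1 T, M t ∈ feasible H du dx β β γ) (hw : ∀ s, ‖w s‖ ≤ W)
    (ht : t ∈ Finset.Icc 1 T) :
    ‖state A B (disturbanceActionController K M w) w t‖ ≤ 2 * β ^ 9 * W := by
  have hβ := hK.one_le
  have hW := (norm_nonneg _).trans (hw 0)
  obtain ⟨ht₁, htT⟩ := Finset.mem_Icc.1 ht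
  refine (hK.norm_le_of_recurrence (R := 2 * β ^ 6 * W) rfl
    (fun t => state_disturbanceActionController_succ) (by positivity) ht₁
    fun s hs hst => ?_).trans_eq (by ring)
  exact hK.norm_add_app_le (hK.norm_perturbation_le
    (hM s (Finset.mem_Icc.2 ⟨hs, by omega⟩)) (norm_pastNoise_le hw s)) (hw s)

theorem norm_sub_le_of_norm_succ_sub_le {E : Type*} [SeminormedAddCommGroup E] {x : ℕ → E} {C : ℝ}
    (hx : ∀ r, 1 ≤ r → r < T → ‖x (r + 1) - x r‖ ≤ C / r) {s : ℕ} (hst : s ≤ t) (htT : t ≤ T)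
    (hts : t ≤ 2 * s) : ‖x s - x t‖ ≤ (t - s : ℕ) * (2 * C / t) := by
  rw [← dist_eq_norm]
  refine (dist_le_Ico_sum_of_dist_le hst (d := fun _ => 2 * C / t) fun {k} hsk hkt => ?_).trans_eq
    (by simp)
  have hk : (0 : ℝ) < k := by exact_mod_cast (by omega : 0 < k)
  have ht : (0 : ℝ) < t := by exact_mod_cast (by omega : 0 < t)
  have htk : (t : ℝ) ≤ 2 * k := by exact_mod_cast (by omega : t ≤ 2 * k)
  have hstep := hx k (by omega) (by omega)
  have hC : 0 ≤ C := (div_le_div_iff_of_pos_right hk).1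
    ((zero_div _).trans_le ((norm_nonneg _).trans hstep))
  rw [dist_comm, dist_eq_norm]
  refine hstep.trans ((div_le_div_iff₀ hk ht).2 ?_)
  exact (mul_le_mul_of_nonneg_left htk hC).trans_eq (by ring)

theorem norm_perturbation_sub_perturbation_le {C : ℝ}
    (hM : ∀ r, 1 ≤ r → r < T → ‖M (r + 1) - M r‖ ≤ C / r) (hw : ∀ s, ‖w s‖ ≤ W)
    (ht : 2 * H + 2 ≤ t) (htT : t ≤ T) {s : ℕ} (hs : t - (H + 1) ≤ s) (hst : s ≤ t) :
    ‖perturbation (pastNoise w s) (M s) - perturbation (pastNoise w s) (M t)‖ ≤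
      H * ((H + 1) * (2 * C / t) * W) := by
  have hW : 0 ≤ W := (norm_nonneg _).trans (hw 0)
  have hMs := norm_sub_le_of_norm_succ_sub_le hM hst htT (by omega)
  have hcount : ((t - s : ℕ) : ℝ) ≤ H + 1 := by exact_mod_cast (by omega : t - s ≤ H + 1)
  have hC : 0 ≤ 2 * C / t := by
    have := (norm_nonneg _).trans (hM 1 le_rfl (by omega))
    rw [Nat.cast_one, div_one] at this
    positivity
  rw [← map_sub]
  refine (norm_perturbation_le_mul _ (norm_pastNoise_le hw s)).trans ?_
  gcongr
  exact hMs.trans (mul_le_mul_of_nonneg_right hcount hC)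

theorem StableRegime.tracks_disturbanceActionController (hK : StableRegime A B β γ K)
    (hH : 1 ≤ H) (hrate : (1 - γ) ^ H ≤ 1 / T) (hW : 0 ≤ W)
    (hM : ∀ t ∈ Finset.Icc 1 T, M t ∈ feasible H du dx β β γ) {C : ℝ}
    (hstep : ∀ r, 1 ≤ r → r < T → ‖M (r + 1) - M r‖ ≤ C / r) :
    Tracks A B K (disturbanceActionController K M) M T W (3 * β ^ 10 * W) (12 * β ^ 14 * W)
      (3 * β ^ 5 * (H * ((H + 1) * (2 * C) * W))) where
  continuous := continuous_disturbanceActionController M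
  norm_le {t} ht {w} hw := by
    have hstate := hK.norm_state_disturbanceActionController_le hM hw ht
    refine ⟨hstate.trans (hK.two_mul_pow_mul_le hW), ?_⟩
    rw [action, disturbanceActionController_eq]
    exact hK.norm_neg_app_add_le hW hstate
      (hK.norm_perturbation_le (hM t ht) (norm_pastNoise_le hw t))
  norm_surrogate_le {t} ht {v} hv := hK.norm_surrogate_le (hM t ht) hv
  dist_le {t} ht {w} hw := by
    obtain ⟨htH, htT⟩ := Finset.mem_Icc.1 ht
    have hβ := hK.one_le
    have hpow : β ^ 4 * W ≤ 2 * β ^ 9 * W := by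
      have := hK.pow_mul_le_pow_mul (m := 4) (n := 9) (by norm_num) hW
      have : 0 ≤ β ^ 9 * W := by positivity
      linarith
    rw [action, disturbanceActionController_eq]
    calc _ ≤ 3 * β ^ 5 * ((1 - γ) ^ H * (2 * β ^ 9 * W) + H * ((H + 1) * (2 * C / t) * W) +
            β ^ 4 * (1 - γ) ^ H * W) :=
          hK.norm_sub_surrogate_le hH (hM t (Finset.mem_Icc.2 ⟨by omega, htT⟩)) hw
            (fun t => state_disturbanceActionController_succ) htH
            (hK.norm_state_disturbanceActionController_le hM hw
              (Finset.mem_Icc.2 ⟨by omega, by omega⟩))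
            fun s hs hst => norm_perturbation_sub_perturbation_le hstep hw htH htT hs hst
      _ = 3 * β ^ 5 * ((1 - γ) ^ H * (2 * β ^ 9 * W + β ^ 4 * W)) +
            3 * β ^ 5 * (H * ((H + 1) * (2 * C) * W)) / t := by ring
      _ ≤ 3 * β ^ 5 * (1 / T * (2 * β ^ 9 * W + 2 * β ^ 9 * W)) +
            3 * β ^ 5 * (H * ((H + 1) * (2 * C) * W)) / t := by gcongr
      _ = 12 * β ^ 14 * W / T + 3 * β ^ 5 * (H * ((H + 1) * (2 * C) * W)) / t := by ring

end DisturbanceAction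

section Linear

variable {dx du H T : ℕ} {A : Matrix (Fin dx) (Fin dx) ℝ} {B : Matrix (Fin dx) (Fin du) ℝ}
  {K K' : Matrix (Fin du) (Fin dx) ℝ} {β γ W : ℝ} {w : ℕ → Vec dx} {t : ℕ}

theorem state_linearController_succ (ht : 1 ≤ t) :
    state A B (linearController K w) w (t + 1) =
      app (A - B * K) (state A B (linearController K w) w t) + w t := by
  rw [state_succ_of_action_eq (q := 0) ht (add_zero _).symm, app_zero, add_zero]

theorem StableRegime.norm_state_linearController_le (hK : StableRegime A B β γ K)
    (hw : ∀ s, ‖w s‖ ≤ W) (ht : 1 ≤ t) :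
    ‖state A B (linearController K w) w t‖ ≤ β ^ 3 * W :=
  hK.norm_le_of_recurrence rfl (fun _ => state_linearController_succ)
    ((norm_nonneg _).trans (hw 0)) ht fun s _ _ => hw s

theorem app_gain_sub_perturbation_imitation (K : Matrix (Fin du) (Fin dx) ℝ) (ht : H < t) :
    app (K - K') (state A B (linearController K' w) w t) -
        perturbation (pastNoise w t) (imitation H A B K K') =
      app (K - K') (app ((A - B * K') ^ H) (state A B (linearController K' w) w (t - H))) := by
  obtain ⟨r, rfl⟩ := Nat.exists_eq_add_of_le' ht.le
  rw [eq_app_pow_add_sum (fun _ => state_linearController_succ) (by omega), app_add,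
    perturbation_apply, app_sum, Finset.sum_range, add_sub_assoc, ← Finset.sum_sub_distrib,
    Finset.sum_eq_zero, add_zero, Nat.add_sub_cancel]
  intro i _
  rw [block_imitation, app_mul, pastNoise_of_lt w (by omega), Nat.sub_sub, add_comm 1, sub_self]

theorem StableRegime.norm_app_gain_sub_perturbation_imitation_le (hK : StableRegime A B β γ K)
    (hK' : StableRegime A B β γ K') (hw : ∀ s, ‖w s‖ ≤ W) (ht : H < t) :
    ‖app (K - K') (state A B (linearController K' w) w t) -
        perturbation (pastNoise w t) (imitation H A B K K')‖ ≤
      2 * β ^ 6 * ((1 - γ) ^ H * W) := by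
  have hgain : ‖K - K'‖ ≤ 2 * β :=
    (norm_sub_le_of_le hK.norm_le hK'.norm_le).trans_eq (two_mul β).symm
  rw [app_gain_sub_perturbation_imitation K ht]
  exact (norm_app_le_of_le hgain (norm_app_le_of_le (hK'.norm_pow_le H)
    (hK'.norm_state_linearController_le hw (by omega)))).trans_eq (by ring)

theorem StableRegime.tracks_linearController (hK : StableRegime A B β γ K)
    (hK' : StableRegime A B β γ K') (hH : 1 ≤ H) (hrate : (1 - γ) ^ H ≤ 1 / T) (hW : 0 ≤ W)
    (hM : imitation H A B K K' ∈ feasible H du dx β β γ) :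
    Tracks A B K (linearController K') (fun _ => imitation H A B K K') T W (3 * β ^ 10 * W)
      (12 * β ^ 14 * W) 0 where
  continuous := continuous_linearController
  norm_le {t} ht {w} hw := by
    have hβ := hK.one_le
    have hstate := hK'.norm_state_linearController_le hw (Finset.mem_Icc.1 ht).1
    have hle : ∀ n ≤ 10, β ^ n * W ≤ 3 * β ^ 10 * W := fun n hn => by
      have := hK.pow_mul_le_pow_mul hn hW
      have : 0 ≤ β ^ 10 * W := by positivity
      linarith
    refine ⟨hstate.trans (hle 3 (by norm_num)), ?_⟩
    rw [action, linearController, norm_neg]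
    refine (norm_app_le_of_le hK'.norm_le hstate).trans
      (le_trans (le_of_eq ?_) (hle 4 (by norm_num)))
    ring
  norm_surrogate_le _ _ hv := hK.norm_surrogate_le hM hv
  dist_le {t} ht {w} hw := by
    have htH := (Finset.mem_Icc.1 ht).1
    have hβ := hK.one_le
    have hpow : β ^ 3 * W + 2 * (β ^ 6 * W) + β ^ 4 * W ≤ 4 * (β ^ 9 * W) := by
      have := hK.pow_mul_le_pow_mul (m := 3) (n := 9) (by norm_num) hW
      have := hK.pow_mul_le_pow_mul (m := 4) (n := 9) (by norm_num) hW
      have := hK.pow_mul_le_pow_mul (m := 6) (n := 9) (by norm_num) hW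
      linarith
    rw [action, linearController_eq K K']
    calc _ ≤ 3 * β ^ 5 * ((1 - γ) ^ H * (β ^ 3 * W) + 2 * β ^ 6 * ((1 - γ) ^ H * W) +
            β ^ 4 * (1 - γ) ^ H * W) :=
          hK.norm_sub_surrogate_le hH hM hw
            (q := fun t => app (K - K') (state A B (linearController K' w) w t))
            (fun t ht => state_succ_of_action_eq ht (linearController_eq K K' w t _)) htH
            (hK'.norm_state_linearController_le hw (by omega))
            fun s hs _ => hK.norm_app_gain_sub_perturbation_imitation_le hK' hw (by omega)
      _ = 3 * β ^ 5 * ((1 - γ) ^ H * (β ^ 3 * W + 2 * (β ^ 6 * W) + β ^ 4 * W)) := by ring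
      _ ≤ 3 * β ^ 5 * (1 / T * (4 * (β ^ 9 * W))) := by gcongr
      _ = 12 * β ^ 14 * W / T + 0 / t := by ring

end Linear

/-! ### Expected cost of a controller that tracks the surrogate -/

theorem sum_one_div_le (T : ℕ) : ∑ t ∈ Finset.Icc 1 T, (1 / t : ℝ) ≤ 1 + Real.log T := by
  have h := harmonic_le_one_add_log T
  rw [harmonic_eq_sum_Icc] at h
  push_cast at h
  simpa only [one_div] using h

theorem sum_le_of_le_early_of_le_late {T k : ℕ} {e : ℕ → ℝ} {a b d : ℝ} (ha : 0 ≤ a) (hb : 0 ≤ b)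
    (hd : 0 ≤ d) (early : ∀ t ∈ Finset.Icc 1 T, e t ≤ a)
    (late : ∀ t ∈ Finset.Icc (k + 1) T, e t ≤ b / T + d / t) :
    ∑ t ∈ Finset.Icc 1 T, e t ≤ k * a + b + d * (1 + Real.log T) := by
  have hsplit : ∀ t ∈ Finset.Icc 1 T,
      e t ≤ (if t ∈ Finset.Icc 1 k then a else 0) + (b / T + d * (1 / t)) := by
    intro t ht
    have hlate : 0 ≤ b / T + d * (1 / t) := by positivity
    obtain ⟨ht₁, htT⟩ := Finset.mem_Icc.1 ht
    split_ifs with h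
    · exact (early t ht).trans (le_add_of_nonneg_right hlate)
    · rw [zero_add, mul_one_div]
      exact late t (Finset.mem_Icc.2 ⟨by rw [Finset.mem_Icc] at h; omega, htT⟩)
  calc ∑ t ∈ Finset.Icc 1 T, e t
      ≤ ∑ t ∈ Finset.Icc 1 T, ((if t ∈ Finset.Icc 1 k then a else 0) + (b / T + d * (1 / t))) :=
        Finset.sum_le_sum hsplit
    _ = (Finset.Icc 1 T ∩ Finset.Icc 1 k).card * a + T * (b / T) +
          d * ∑ t ∈ Finset.Icc 1 T, (1 / t : ℝ) := by
        rw [Finset.sum_add_distrib, Finset.sum_add_distrib, ← Finset.mul_sum, Finset.sum_ite_mem,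
          Finset.sum_const, Finset.sum_const, Nat.card_Icc, Nat.add_sub_cancel, nsmul_eq_mul,
          nsmul_eq_mul, add_assoc]
    _ ≤ k * a + b + d * (1 + Real.log T) := by
        gcongr
        · exact (Finset.card_le_card Finset.inter_subset_right).trans_eq (by simp)
        · rw [mul_div_left_comm]
          exact mul_le_of_le_one_right hb (div_self_le_one (T : ℝ))
        · exact sum_one_div_le T

section ExpectedCost

variable {dx du H T : ℕ} {μ : Measure (Vec dx)} {σ W D b d α G : ℝ}
  {A : Matrix (Fin dx) (Fin dx) ℝ} {B : Matrix (Fin dx) (Fin du) ℝ}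
  {K : Matrix (Fin du) (Fin dx) ℝ} {π : (ℕ → Vec dx) → ℕ → Vec dx → Vec du}
  {M : ℕ → Param H du dx} {c : ℕ → Vec dx → Vec du → ℝ} {Ω : Type*} [MeasurableSpace Ω]
  {P : Measure Ω} {w : ℕ → Ω → Vec dx}

theorem NoiseLaw.ae_forall_norm_le (h : NoiseLaw μ σ W) (hw : ∀ t, HasLaw (w t) μ P) :
    ∀ᵐ ω ∂P, ∀ s, ‖w s ω‖ ≤ W :=
  ae_all_iff.2 fun s => h.ae_norm_le (hw s)

variable [IsProbabilityMeasure P]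

theorem integral_window (hw : ∀ t, HasLaw (w t) μ P) (hind : iIndepFun w P) (t : ℕ)
    {g : (Fin (2 * H) → Vec dx) → ℝ} (hg : Continuous g) :
    ∫ ω, g (window H (fun s => w s ω) t) ∂P =
      ∫ v, g v ∂(Measure.pi fun _ : Fin (2 * H) => μ) := by
  have hinj : Function.Injective fun k : Fin (2 * H) => t - 2 * H + (k : ℕ) := fun i j hij =>
    Fin.ext (Nat.add_left_cancel hij)
  have hmeas (k : Fin (2 * H)) : AEMeasurable (w (t - 2 * H + k)) P := (hw _).aemeasurable
  have hmap := (iIndepFun_iff_map_fun_eq_pi_map hmeas).1 (hind.precomp hinj)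
  simp only [(hw _).map_eq] at hmap
  rw [← hmap, integral_map (aemeasurable_pi_lambda _ hmeas) hg.aestronglyMeasurable]
  rfl

theorem NoiseLaw.integrable_comp_path (h : NoiseLaw μ σ W) (hw : ∀ t, HasLaw (w t) μ P)
    {f : (ℕ → Vec dx) → ℝ} (hf : Continuous f) : Integrable (fun ω => f fun s => w s ω) P := by
  obtain ⟨C, hC⟩ := (isCompact_univ_pi fun _ : ℕ =>
    isCompact_closedBall (0 : Vec dx) W).exists_bound_of_continuousOn hf.continuousOn
  refine Integrable.of_bound (hf.measurable.comp_aemeasurable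
    (aemeasurable_pi_lambda _ fun s => (hw s).aemeasurable)).aestronglyMeasurable C ?_
  filter_upwards [h.ae_forall_norm_le hw] with ω hω
  exact hC _ fun s _ => mem_closedBall_zero_iff.2 (hω s)

theorem continuous_cost_action {c : Vec dx → Vec du → ℝ} (hc : CostCondition c α G W)
    (hπ : ∀ t, Continuous fun p : (ℕ → Vec dx) × Vec dx => π p.1 t p.2) (t : ℕ) :
    Continuous fun w : ℕ → Vec dx => c (state A B (π w) w t) (action A B π w t) :=
  have hstate := continuous_state hπ t
  hc.differentiable.continuous.comp (hstate.prodMk ((hπ t).comp (continuous_id.prodMk hstate)))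

theorem Tracks.abs_integral_sub_surrogateCost_le (hπ : Tracks A B K π M T W D b d)
    (h : NoiseLaw μ σ W) (hw : ∀ t, HasLaw (w t) μ P) (hind : iIndepFun w P)
    (hc : ∀ t, CostCondition (c t) α G W) (hD : W ≤ D) {t : ℕ} (ht : t ∈ Finset.Icc 1 T) {δ : ℝ}
    (hδ : ∀ w : ℕ → Vec dx, (∀ s, ‖w s‖ ≤ W) →
      ‖state A B (π w) w t - surrogateState A B K (M t) (window H w t)‖ +
        ‖action A B π w t - surrogateAction A B K (M t) (window H w t)‖ ≤ δ) :
    |∫ ω, c t (state A B (π fun s => w s ω) (fun s => w s ω) t)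
        (action A B π (fun s => w s ω) t) ∂P - surrogateCost μ A B K (c t) (M t)| ≤
      G * D * δ := by
  have hcost := continuous_cost_action (A := A) (B := B) (hc t) hπ.continuous t
  have hsurrogate : Continuous fun v : Fin (2 * H) → Vec dx =>
      c t (surrogateState A B K (M t) v) (surrogateAction A B K (M t) v) :=
    (hc t).differentiable.continuous.comp
      ((WithLp.prod_continuous_ofLp 2 _ _).comp (continuous_surrogate A B K (M t)))
  have hwindow : Continuous fun w : ℕ → Vec dx =>
      c t (surrogateState A B K (M t) (window H w t))
        (surrogateAction A B K (M t) (window H w t)) :=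
    hsurrogate.comp (continuous_pi fun k => continuous_apply _)
  rw [surrogateCost, ← integral_window hw hind t hsurrogate, ← integral_sub
    (h.integrable_comp_path hw hcost) (h.integrable_comp_path hw hwindow),
    ← Real.norm_eq_abs, ← mul_one (G * D * δ), ← probReal_univ (μ := P)]
  refine norm_integral_le_of_norm_le_const ?_
  filter_upwards [h.ae_forall_norm_le hw] with ω hω
  obtain ⟨hx, hu⟩ := hπ.norm_le ht hω
  obtain ⟨hy, hv⟩ := hπ.norm_surrogate_le ht (norm_window_le (H := H) hω t)
  exact ((hc t).abs_sub_le hD hx hu hy hv).trans (mul_le_mul_of_nonneg_left (hδ _ hω)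
    ((hc t).slope_nonneg hD (h.bound_nonneg.trans hD)))

theorem Tracks.abs_expectedCost_sub_le (hπ : Tracks A B K π M T W D b d)
    (h : NoiseLaw μ σ W) (hw : ∀ t, HasLaw (w t) μ P) (hind : iIndepFun w P)
    (hc : ∀ t, CostCondition (c t) α G W) (hD : W ≤ D) (hb : 0 ≤ b) (hd : 0 ≤ d) :
    |expectedCost P w A B c T π - ∑ t ∈ Finset.Icc 1 T, surrogateCost μ A B K (c t) (M t)| ≤
      G * D * ((2 * H + 1) * (4 * D) + b + d * (1 + Real.log T)) := by
  have hD₀ : 0 ≤ D := h.bound_nonneg.trans hD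
  have hslope : 0 ≤ G * D := (hc 0).slope_nonneg hD hD₀
  have hround := fun t => hπ.abs_integral_sub_surrogateCost_le h hw hind hc hD (t := t)
  have hcost : expectedCost P w A B c T π = ∑ t ∈ Finset.Icc 1 T,
      ∫ ω, c t (state A B (π fun s => w s ω) (fun s => w s ω) t)
        (action A B π (fun s => w s ω) t) ∂P :=
    integral_finsetSum _ fun t _ =>
      h.integrable_comp_path hw (continuous_cost_action (hc t) hπ.continuous t)
  rw [hcost, ← Finset.sum_sub_distrib]
  refine (Finset.abs_sum_le_sum_abs _ _).trans ((sum_le_of_le_early_of_le_late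
    (k := 2 * H + 1) (a := G * D * (4 * D)) (b := G * D * b) (d := G * D * d) (by positivity)
    (by positivity) (by positivity) (fun t ht => ?_) fun t ht => ?_).trans_eq
      (by push_cast; ring))
  · refine hround t ht fun v hv => ?_
    obtain ⟨hx, hu⟩ := hπ.norm_le ht hv
    obtain ⟨hy, hv⟩ := hπ.norm_surrogate_le ht (norm_window_le (H := H) hv t)
    exact (add_le_add (norm_sub_le_of_le hx hy) (norm_sub_le_of_le hu hv)).trans_eq (by ring)
  · obtain ⟨htH, htT⟩ := Finset.mem_Icc.1 ht
    exact (hround t (Finset.mem_Icc.2 ⟨by omega, htT⟩) fun v hv => hπ.dist_le ht hv).trans_eq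
      (by ring)

end ExpectedCost

/-! ### Online natural gradient iterates -/

section Iterates

variable {dx du H : ℕ} {μ : Measure (Vec dx)} {σ W κ κB γ α G D s : ℝ}
  {A : Matrix (Fin dx) (Fin dx) ℝ} {B : Matrix (Fin dx) (Fin du) ℝ}
  {K : Matrix (Fin du) (Fin dx) ℝ} {c : ℕ → Vec dx → Vec du → ℝ} {η : ℕ → ℝ} {T : ℕ}
  {M : ℕ → Param H du dx}

theorem NaturalGradientIterates.mem_feasible
    (hM : NaturalGradientIterates μ A B K κ κB γ c η T M) {t : ℕ} (ht : t ∈ Finset.Icc 1 T) :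
    M t ∈ feasible H du dx κ κB γ := by
  obtain ⟨ht₁, htT⟩ := Finset.mem_Icc.1 ht
  obtain ⟨k, rfl⟩ := Nat.exists_eq_add_of_le' ht₁
  rcases k with _ | k
  · exact hM.1
  · exact (hM.2 (k + 1) (by omega) (by omega)).1

theorem NaturalGradientIterates.norm_succ_sub_le
    (hM : NaturalGradientIterates μ A B K κ κB γ c η T M) (h : NoiseLaw μ σ W) (hσ : 0 < σ)
    {β : ℝ} (hβ : 1 ≤ β) (hK : ‖K‖ ≤ β) (hc : ∀ t, CostCondition (c t) α G W) (hα : 0 ≤ α)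
    (hD : W ≤ D)
    (hbound : ∀ N ∈ feasible H du dx κ κB γ, ∀ v, ‖v‖ ≤ W →
      ‖surrogateState A B K N v‖ ≤ D ∧ ‖surrogateAction A B K N v‖ ≤ D)
    {t : ℕ} (ht : 1 ≤ t) (htT : t < T) (hη : 0 ≤ η t) :
    ‖M (t + 1) - M t‖ ≤ 4 * β * (G * D) / σ * η t := by
  have hslope := (hc t).slope_nonneg hD (h.bound_nonneg.trans hD)
  have hMt := hM.mem_feasible (Finset.mem_Icc.2 ⟨ht, htT.le⟩)
  have hstep := (div_mul_norm_sq_le_sqNorm_expectedGram A B K h hK (M (t + 1) - M t)).trans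
    (sqNorm_sub_le_of_isProj_step (posDef_expectedGram A B K h hσ) convex_feasible hMt
      (hM.2 t ht htT)
      (sq_inner_gradient_surrogateCost_le A B K h (hc t) hα hD (hbound _ hMt)))
  have hβsq : 1 + β ^ 2 ≤ (2 * β) ^ 2 := by nlinarith
  refine le_of_sq_le_sq ?_ (by positivity)
  rw [div_mul_eq_mul_div, div_le_iff₀ (by positivity)] at hstep
  calc ‖M (t + 1) - M t‖ ^ 2 ≤ η t ^ 2 * (2 * (G * D)) ^ 2 * (2 * β) ^ 2 / σ ^ 2 := by
        rw [le_div_iff₀' (by positivity)]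
        exact hstep.trans (mul_le_mul_of_nonneg_left hβsq (by positivity))
    _ = (4 * β * (G * D) / σ * η t) ^ 2 := by ring

theorem NaturalGradientIterates.sum_surrogateCost_sub_le
    (hM : NaturalGradientIterates μ A B K κ κB γ c (fun t => s / (α * t)) T M)
    (h : NoiseLaw μ σ W) (hσ : 0 < σ) (hc : ∀ t, CostCondition (c t) α G W) (hα : 0 < α)
    (hs : 1 ≤ s) (hD : W ≤ D)
    (hbound : ∀ N ∈ feasible H du dx κ κB γ, ∀ v, ‖v‖ ≤ W →
      ‖surrogateState A B K N v‖ ≤ D ∧ ‖surrogateAction A B K N v‖ ≤ D)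
    {N : Param H du dx} (hN : N ∈ feasible H du dx κ κB γ) :
    ∑ t ∈ Finset.Icc 1 T, (surrogateCost μ A B K (c t) (M t) - surrogateCost μ A B K (c t) N) ≤
      2 * (s / α) * (G * D) ^ 2 * (1 + Real.log T) :=
  calc ∑ t ∈ Finset.Icc 1 T, (surrogateCost μ A B K (c t) (M t) - surrogateCost μ A B K (c t) N)
      ≤ s / (2 * α) * (2 * (G * D)) ^ 2 * ∑ t ∈ Finset.Icc 1 T, (1 / t : ℝ) :=
        sum_le_of_isProj_step (posDef_expectedGram A B K h hσ) convex_feasible hα hs hN hM.2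
          (fun t _ => surrogateCost_sub_le A B K h (hc t) hα.le (M t) N)
          fun t ht => sq_inner_gradient_surrogateCost_le A B K h (hc t) hα.le hD
            (hbound _ (hM.mem_feasible ht))
    _ ≤ s / (2 * α) * (2 * (G * D)) ^ 2 * (1 + Real.log T) :=
        mul_le_mul_of_nonneg_left (sum_one_div_le T) (by positivity)
    _ = 2 * (s / α) * (G * D) ^ 2 * (1 + Real.log T) := by ring

end Iterates

/-! ### Regret bound -/

section Regret

variable {dx du H T : ℕ} {μ : Measure (Vec dx)} {σ W β κ κB γ α G s : ℝ}
  {A : Matrix (Fin dx) (Fin dx) ℝ} {B : Matrix (Fin dx) (Fin du) ℝ}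
  {K K' : Matrix (Fin du) (Fin dx) ℝ} {c : ℕ → Vec dx → Vec du → ℝ} {M : ℕ → Param H du dx}
  {Ω : Type*} [MeasurableSpace Ω] {P : Measure Ω} [IsProbabilityMeasure P] {w : ℕ → Ω → Vec dx}

theorem StableRegime.expectedCost_sub_le (hK : StableRegime A B β γ K)
    (hK' : StableRegime A B β γ K') (hH : 1 ≤ H) (hrate : (1 - γ) ^ H ≤ 1 / T)
    (h : NoiseLaw μ σ W) (hw : ∀ t, HasLaw (w t) μ P) (hind : iIndepFun w P)
    (hc : ∀ t, CostCondition (c t) α G W) (hσ : 0 < σ) (hα : 0 < α) (hs : 1 ≤ s)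
    (hM : NaturalGradientIterates μ A B K κ κB γ c (fun t => s / (α * t)) T M)
    (hsubset : feasible H du dx κ κB γ ⊆ feasible H du dx β β γ)
    (himitation : imitation H A B K K' ∈ feasible H du dx κ κB γ) :
    expectedCost P w A B c T (disturbanceActionController K M) -
        expectedCost P w A B c T (linearController K') ≤
      72 * β ^ 20 * (2 * H + 1) * (G * W ^ 2) + 72 * β ^ 24 * (G * W ^ 2) +
        (216 * β ^ 26 * (H * (H + 1)) * (s / α * G ^ 2 * W ^ 3 / σ) +
          18 * β ^ 20 * (s / α * G ^ 2 * W ^ 2)) * (1 + Real.log T) := by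
  have hβ := hK.one_le
  have hW := h.bound_nonneg
  have hD : W ≤ 3 * β ^ 10 * W :=
    le_mul_of_one_le_left hW (by linarith [one_le_pow₀ hβ (n := 10)])
  have hslope := (hc 0).slope_nonneg hD (hW.trans hD)
  have hbound : ∀ N ∈ feasible H du dx κ κB γ, ∀ v, ‖v‖ ≤ W →
      ‖surrogateState A B K N v‖ ≤ 3 * β ^ 10 * W ∧
        ‖surrogateAction A B K N v‖ ≤ 3 * β ^ 10 * W := fun N hN v hv =>
    hK.norm_surrogate_le (hsubset hN) hv
  have hstep : ∀ r, 1 ≤ r → r < T → ‖M (r + 1) - M r‖ ≤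
      4 * β * (G * (3 * β ^ 10 * W)) / σ * (s / α) / r := fun r hr hrT =>
    (hM.norm_succ_sub_le h hσ hβ hK.norm_le hc hα.le hD hbound hr hrT (by positivity)).trans_eq
      (by ring)
  have hlearner := le_of_abs_le <| (hK.tracks_disturbanceActionController (M := M) hH hrate hW
    (fun t ht => hsubset (hM.mem_feasible ht)) hstep).abs_expectedCost_sub_le h hw hind hc hD
    (by positivity) (by positivity)
  have hcomparator := neg_le_of_abs_le <| (hK.tracks_linearController hK' hH hrate hW
    (hsubset himitation)).abs_expectedCost_sub_le h hw hind hc hD (by positivity) le_rfl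
  have hregret := hM.sum_surrogateCost_sub_le h hσ hc hα hs hD hbound himitation
  rw [Finset.sum_sub_distrib] at hregret
  exact (le_of_eq (by ring)).trans
    ((add_le_add (add_le_add hlearner hregret) (neg_le.1 hcomparator)).trans_eq (by ring))

end Regret

/-! ### Choice of the horizon and constants -/

section Horizon

variable {γ κ β x : ℝ}

theorem one_sub_pow_ceil_le (hγ : 0 < γ) (hγ1 : γ ≤ 1) (hx : 0 < x) :
    (1 - γ) ^ ⌈γ⁻¹ * Real.log x⌉₊ ≤ 1 / x := by
  set H := ⌈γ⁻¹ * Real.log x⌉₊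
  have hlog : Real.log x ≤ γ * H := (inv_mul_le_iff₀ hγ).1 (Nat.le_ceil _)
  calc (1 - γ) ^ H ≤ Real.exp (-γ) ^ H :=
        pow_le_pow_left₀ (sub_nonneg.2 hγ1) (Real.one_sub_le_exp_neg γ) H
    _ = Real.exp (-(γ * H)) := by rw [← Real.exp_nat_mul, mul_neg, mul_comm]
    _ ≤ Real.exp (-Real.log x) := Real.exp_le_exp.2 (neg_le_neg hlog)
    _ = 1 / x := by rw [Real.exp_neg, Real.exp_log hx, one_div]

theorem half_le_log (hx : 2 ≤ x) : 1 / 2 ≤ Real.log x := by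
  linarith [Real.log_le_log two_pos hx, Real.log_two_gt_d9]

theorem one_le_ceil_inv_mul_log (hγ : 0 < γ) (hx : 1 < x) : 1 ≤ ⌈γ⁻¹ * Real.log x⌉₊ :=
  Nat.ceil_pos.2 (mul_pos (inv_pos.2 hγ) (Real.log_pos hx))

theorem ceil_inv_mul_log_mul_sq_le (hγ : 0 < γ) (hγβ : γ⁻¹ ≤ β) (hκ : 1 ≤ κ) (hκβ : κ ≤ β)
    (hx : 2 ≤ x) : (⌈γ⁻¹ * Real.log (x * κ ^ 2)⌉₊ : ℝ) ≤ 7 * β ^ 2 * Real.log x := by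
  have hL := half_le_log hx
  have hβ : 1 ≤ β := hκ.trans hκβ
  have hlogκ : Real.log κ ≤ β := (Real.log_le_self (zero_le_one.trans hκ)).trans hκβ
  have hlog : Real.log (x * κ ^ 2) = Real.log x + 2 * Real.log κ := by
    rw [Real.log_mul (by positivity) (by positivity), Real.log_pow, Nat.cast_ofNat]
  have hlog₀ : 0 ≤ Real.log (x * κ ^ 2) := by linarith [Real.log_nonneg hκ]
  calc (⌈γ⁻¹ * Real.log (x * κ ^ 2)⌉₊ : ℝ) ≤ γ⁻¹ * Real.log (x * κ ^ 2) + 1 :=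
        (Nat.ceil_lt_add_one (by positivity)).le
    _ ≤ β * (Real.log x + 2 * β) + 1 := by
        rw [hlog] at hlog₀ ⊢
        gcongr
    _ ≤ β ^ 2 * Real.log x + 2 * β ^ 2 + β ^ 2 := by
        nlinarith [mul_le_mul_of_nonneg_right (le_self_pow₀ hβ two_ne_zero)
          (by linarith : 0 ≤ Real.log x)]
    _ ≤ 7 * β ^ 2 * Real.log x := by nlinarith [one_le_pow₀ hβ (n := 2)]

end Horizon

section Constants

variable {β σ W α G s L h : ℝ}

theorem mul_pow_three_div_le (hσ : 0 < σ) (hσW : σ ≤ W) (hα : 0 < α) (hs : 0 ≤ s) :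
    s / α * G ^ 2 * W ^ 3 / σ ≤ s * (G ^ 2 * W ^ 4 / (α * σ ^ 2)) := by
  have hW := hσ.trans_le hσW
  calc s / α * G ^ 2 * W ^ 3 / σ ≤ s / α * G ^ 2 * W ^ 3 / σ * (W / σ) :=
        le_mul_of_one_le_right (by positivity) ((one_le_div hσ).2 hσW)
    _ = s * (G ^ 2 * W ^ 4 / (α * σ ^ 2)) := by field_simp

theorem mul_sq_le (hσ : 0 < σ) (hσW : σ ≤ W) (hα : 0 < α) (hs : 0 ≤ s) :
    s / α * G ^ 2 * W ^ 2 ≤ s * (G ^ 2 * W ^ 4 / (α * σ ^ 2)) := by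
  refine le_trans ?_ (mul_pow_three_div_le hσ hσW hα hs)
  have hW := hσ.trans_le hσW
  calc s / α * G ^ 2 * W ^ 2 ≤ s / α * G ^ 2 * W ^ 2 * (W / σ) :=
        le_mul_of_one_le_right (by positivity) ((one_le_div hσ).2 hσW)
    _ = s / α * G ^ 2 * W ^ 3 / σ := by ring

theorem slope_mul_sq_le (hσ : 0 < σ) (hσW : σ ≤ W) (hα : 0 < α) (hαG : α ≤ 4 * G) (hs : 1 ≤ s) :
    G * W ^ 2 ≤ 4 * (s * (G ^ 2 * W ^ 4 / (α * σ ^ 2))) := by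
  have hG : 0 ≤ G := by linarith
  calc G * W ^ 2 ≤ s * (4 * G / α) * (G * W ^ 2) :=
        le_mul_of_one_le_left (by positivity)
          (one_le_mul_of_one_le_of_one_le hs ((one_le_div hα).2 hαG))
    _ = 4 * (s / α * G ^ 2 * W ^ 2) := by ring
    _ ≤ 4 * (s * (G ^ 2 * W ^ 4 / (α * σ ^ 2))) :=
        mul_le_mul_of_nonneg_left (mul_sq_le hσ hσW hα (zero_le_one.trans hs)) (by norm_num)

theorem regret_terms_le (hβ : 1 ≤ β) (hL : 1 / 2 ≤ L) (hh : 0 ≤ h) (hhL : h ≤ 7 * β ^ 2 * L)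
    {a b d V : ℝ} (hV : 0 ≤ V) (ha : a ≤ 4 * V) (hb : b ≤ V) (hd : d ≤ V) :
    72 * β ^ 20 * (2 * h + 1) * a + 72 * β ^ 24 * a +
        (216 * β ^ 26 * (h * (h + 1)) * b + 18 * β ^ 20 * d) * (1 + L) ≤
      1000000 * β ^ 30 * V * L ^ 7 := by
  have hβL : 1 ≤ 2 * β ^ 2 * L := by nlinarith [one_le_pow₀ hβ (n := 2)]
  have hpow : ∀ n ≤ 30, β ^ n ≤ β ^ 30 := fun n hn => pow_le_pow_right₀ hβ hn
  have hL₁ : L ≤ 64 * L ^ 7 := by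
    nlinarith [pow_le_pow_left₀ (by norm_num) hL 6]
  have hL₃ : L ^ 3 ≤ 16 * L ^ 7 := by
    nlinarith [mul_le_mul_of_nonneg_left (pow_le_pow_left₀ (by norm_num) hL 4)
      (by positivity : 0 ≤ L ^ 3)]
  have hinit : 2 * h + 1 ≤ 16 * β ^ 2 * L := by linarith
  have hdelay : h * (h + 1) ≤ 7 * β ^ 2 * L * (9 * β ^ 2 * L) := by
    gcongr
    linarith
  calc 72 * β ^ 20 * (2 * h + 1) * a + 72 * β ^ 24 * a +
        (216 * β ^ 26 * (h * (h + 1)) * b + 18 * β ^ 20 * d) * (1 + L)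
      ≤ 72 * β ^ 20 * (2 * h + 1) * (4 * V) + 72 * β ^ 24 * (4 * V) +
        (216 * β ^ 26 * (h * (h + 1)) * V + 18 * β ^ 20 * V) * (1 + L) := by gcongr
    _ ≤ 72 * β ^ 20 * (16 * β ^ 2 * L) * (4 * V) + 72 * β ^ 24 * (4 * V) +
        (216 * β ^ 26 * (7 * β ^ 2 * L * (9 * β ^ 2 * L)) * V + 18 * β ^ 20 * V) * (3 * L) := by
        gcongr
        linarith
    _ = V * (4608 * β ^ 22 * L + 288 * β ^ 24 + 40824 * β ^ 30 * L ^ 3 + 54 * β ^ 20 * L) := by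
        ring
    _ ≤ V * (4608 * β ^ 30 * (64 * L ^ 7) + 288 * β ^ 30 * (128 * L ^ 7) +
          40824 * β ^ 30 * (16 * L ^ 7) + 54 * β ^ 30 * (64 * L ^ 7)) := by
        have hone : 288 * β ^ 24 ≤ 288 * β ^ 30 * (128 * L ^ 7) :=
          (mul_le_mul_of_nonneg_left (hpow 24 (by norm_num)) (by norm_num)).trans
            (le_mul_of_one_le_right (by positivity) (by linarith))
        have := hpow 22 (by norm_num)
        have := hpow 20 (by norm_num)
        gcongr
    _ = 988416 * (β ^ 30 * V * L ^ 7) := by ring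
    _ ≤ 1000000 * (β ^ 30 * V * L ^ 7) := by
        gcongr
        norm_num
    _ = 1000000 * β ^ 30 * V * L ^ 7 := by ring

end Constants

section Regime

variable {dx du : ℕ} {κ γ κB : ℝ} {A : Matrix (Fin dx) (Fin dx) ℝ}
  {B : Matrix (Fin dx) (Fin du) ℝ} {K : Matrix (Fin du) (Fin dx) ℝ}

theorem le_inv_mul_mul_mul {n : ℝ} (hκ : 1 ≤ κ) (hγ : 0 < γ) (hγ1 : γ ≤ 1) (hκB : 1 ≤ κB)
    (hn : 1 ≤ n) :
    γ⁻¹ ≤ γ⁻¹ * κB * κ * n ∧ κB ≤ γ⁻¹ * κB * κ * n ∧ κ ≤ γ⁻¹ * κB * κ * n := by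
  have hγinv : 1 ≤ γ⁻¹ := (one_le_inv₀ hγ).2 hγ1
  have hκn := one_le_mul_of_one_le_of_one_le hκ hn
  refine ⟨?_, ?_, ?_⟩
  · calc γ⁻¹ ≤ γ⁻¹ * (κB * (κ * n)) :=
          le_mul_of_one_le_right (by positivity) (one_le_mul_of_one_le_of_one_le hκB hκn)
      _ = γ⁻¹ * κB * κ * n := by ring
  · calc κB ≤ κB * (γ⁻¹ * (κ * n)) :=
          le_mul_of_one_le_right (by positivity) (one_le_mul_of_one_le_of_one_le hγinv hκn)
      _ = γ⁻¹ * κB * κ * n := by ring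
  · calc κ ≤ κ * (γ⁻¹ * κB * n) := le_mul_of_one_le_right (by positivity)
          (one_le_mul_of_one_le_of_one_le (one_le_mul_of_one_le_of_one_le hγinv hκB) hn)
      _ = γ⁻¹ * κB * κ * n := by ring

theorem PowerStable.stableRegime {β : ℝ} (hK : PowerStable A B κ γ K) (hκ : 0 ≤ κ) (hγ : 0 < γ)
    (hγ1 : γ < 1) (hγβ : γ⁻¹ ≤ β) (hκβ : κ ≤ β) (hB : ‖B‖ ≤ β) : StableRegime A B β γ K where
  norm_le := hK.norm_le.trans hκβ
  norm_pow_le k := (hK.norm_pow_le k).trans (mul_le_mul_of_nonneg_right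
    (pow_le_pow_left₀ hκ hκβ 2) (pow_nonneg (sub_nonneg.2 hγ1.le) k))
  gamma_pos := hγ
  gamma_lt_one := hγ1
  inv_gamma_le := hγβ
  norm_input_le := hB

end Regime

end OnlineControl

open OnlineControl in
theorem corollary1_general :
    ∃ (C : ℝ) (n : ℕ), 0 < C ∧
      ∀ (dx du : ℕ), 0 < dx →
      ∀ (A : Matrix (Fin dx) (Fin dx) ℝ) (B : Matrix (Fin dx) (Fin du) ℝ)
        (K₀ : Matrix (Fin du) (Fin dx) ℝ)
        (κ γ κB σ W α G s : ℝ) (T H : ℕ)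
        (μ : Measure (Vec dx))
        (c : ℕ → Vec dx → Vec du → ℝ)
        {Ω : Type*} [MeasurableSpace Ω] (P : Measure Ω)
        [IsProbabilityMeasure P]
        (w : ℕ → Ω → Vec dx)
        (M : ℕ → Param H du dx),
        1 ≤ κ → 0 < γ → γ < 1 → ‖B‖ ≤ κB → 2 ≤ κB * (1 - γ) →
        0 < σ → 0 < α → 1 ≤ s → 2 ≤ T →
        PowerStable A B κ γ K₀ →
        NoiseLaw μ σ W →
        (∀ t, HasLaw (w t) μ P) →
        iIndepFun w P →
        (∀ t, CostCondition (c t) α G W) →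
        H = ⌈γ⁻¹ * Real.log (T * κ ^ 2)⌉₊ →
        NaturalGradientIterates μ A B K₀ κ κB γ c
          (fun t => s / (α * t)) T M →
        (expectedGram H μ A B K₀ -
          (γ ^ 2 * σ ^ 2 / (36 * κ ^ 10)) •
            (1 : Matrix (Fin H × Fin du × Fin dx) (Fin H × Fin du × Fin dx) ℝ)).PosSemidef ∧
        ∀ K : Matrix (Fin du) (Fin dx) ℝ, PowerStable A B κ γ K →
          expectedCost P w A B c T
              (disturbanceActionController K₀ M) -
            expectedCost P w A B c T (linearController K) ≤
          C * (γ⁻¹ * κB * κ * (max dx du : ℕ)) ^ n * s *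
            (G ^ 2 * W ^ 4 / (α * σ ^ 2)) * Real.log T ^ 7 := by
  refine ⟨1000000, 30, by norm_num, ?_⟩
  intro dx du hdx A B K₀ κ γ κB σ W α G s T H μ c Ω _ P _ w M hκ hγ hγ1 hB hκB hσ hα hs hT hK₀
    hμ hw hind hc hH hM
  refine ⟨posSemidef_expectedGram_sub A B K₀ hμ hκ hγ.le hγ1.le hK₀.norm_le, fun K hK => ?_⟩
  set β : ℝ := γ⁻¹ * κB * κ * (max dx du : ℕ)
  have hκB1 : 1 ≤ κB := by nlinarith
  have hT2 : (2 : ℝ) ≤ T := mod_cast hT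
  have hdim : (1 : ℝ) ≤ (max dx du : ℕ) := mod_cast hdx.trans_le (le_max_left dx du)
  obtain ⟨hγβ, hκBβ, hκβ⟩ := le_inv_mul_mul_mul hκ hγ hγ1.le hκB1 hdim
  have hregime : ∀ {K}, PowerStable A B κ γ K → StableRegime A B β γ K := fun hK =>
    hK.stableRegime (by linarith) hγ hγ1 hγβ hκβ (hB.trans hκBβ)
  have hTκ : (T : ℝ) ≤ T * κ ^ 2 := le_mul_of_one_le_right (by positivity) (one_le_pow₀ hκ)
  have hHpos : 1 ≤ H := hH ▸ one_le_ceil_inv_mul_log hγ (by linarith)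
  have hrate : (1 - γ) ^ H ≤ 1 / T := hH ▸ (one_sub_pow_ceil_le hγ hγ1.le (by positivity)).trans
    (one_div_le_one_div_of_le (by positivity) hTκ)
  have hHle : (H : ℝ) ≤ 7 * β ^ 2 * Real.log T :=
    hH ▸ ceil_inv_mul_log_mul_sq_le hγ hγβ hκ hκβ hT2
  have hσW := hμ.le_bound hdx
  have hαG := (hc 0).convexity_le_slope (hσ.trans_le hσW) hdx
  calc _ ≤ _ := (hregime hK₀).expectedCost_sub_le (hregime hK) hHpos hrate hμ hw hind hc hσ hα hs
        hM (feasible_subset_feasible (by linarith) (by linarith) hγ1.le hκβ hκBβ)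
        (imitation_mem_feasible (by linarith) hγ1.le hκB hK₀ hK)
    _ ≤ 1000000 * β ^ 30 * (s * (G ^ 2 * W ^ 4 / (α * σ ^ 2))) * Real.log T ^ 7 :=
        regret_terms_le (hregime hK).one_le (half_le_log hT2) H.cast_nonneg hHle (by positivity)
          (slope_mul_sq_le hσ hσW hα hαG hs) (mul_pow_three_div_le hσ hσW hα (by linarith))
          (mul_sq_le hσ hσW hα (by linarith))
    _ = 1000000 * β ^ 30 * s * (G ^ 2 * W ^ 4 / (α * σ ^ 2)) * Real.log T ^ 7 := by ring

theorem corollary1 :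
    ∃ (C : ℝ) (n : ℕ), 0 < C ∧
      ∀ (dx du : ℕ), 0 < dx → 0 < du →
      ∀ (A : Matrix (Fin dx) (Fin dx) ℝ) (B : Matrix (Fin dx) (Fin du) ℝ)
        (K₀ : Matrix (Fin du) (Fin dx) ℝ)
        (κ γ κB σ W α G s : ℝ) (T H : ℕ)
        (μ : MeasureTheory.Measure (OnlineControl.Vec dx))
        (c : ℕ → OnlineControl.Vec dx → OnlineControl.Vec du → ℝ)
        {Ω : Type*} [MeasurableSpace Ω] (P : MeasureTheory.Measure Ω)
        [MeasureTheory.IsProbabilityMeasure P]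
        (w : ℕ → Ω → OnlineControl.Vec dx)
        (M : ℕ → OnlineControl.Param H du dx),
        1 ≤ κ → 0 < γ → γ < 1 → ‖B‖ ≤ κB → 2 ≤ κB * (1 - γ) →
        0 < σ → 0 < α → 1 ≤ s → 2 ≤ T →
        OnlineControl.DiagStronglyStable A B κ γ K₀ →
        OnlineControl.NoiseLaw μ σ W →
        (∀ t, ProbabilityTheory.HasLaw (w t) μ P) →
        ProbabilityTheory.iIndepFun w P →
        (∀ t, OnlineControl.CostCondition (c t) α G W) →
        H = ⌈γ⁻¹ * Real.log (T * κ ^ 2)⌉₊ →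
        OnlineControl.NaturalGradientIterates μ A B K₀ κ κB γ c
          (fun t => s / (α * t)) T M →
        (OnlineControl.expectedGram H μ A B K₀ -
          (γ ^ 2 * σ ^ 2 / (36 * κ ^ 10)) •
            (1 : Matrix (Fin H × Fin du × Fin dx) (Fin H × Fin du × Fin dx) ℝ)).PosSemidef ∧
        ∀ K : Matrix (Fin du) (Fin dx) ℝ, OnlineControl.DiagStronglyStable A B κ γ K →
          OnlineControl.expectedCost P w A B c T
              (OnlineControl.disturbanceActionController K₀ M) -
            OnlineControl.expectedCost P w A B c T (OnlineControl.linearController K) ≤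
          C * (γ⁻¹ * κB * κ * (max dx du : ℕ)) ^ n * s *
            (G ^ 2 * W ^ 4 / (α * σ ^ 2)) * Real.log T ^ 7 := by
  obtain ⟨C, n, hC, h⟩ := corollary1_general
  exact ⟨C, n, hC, fun dx du hdx _ A B K₀ κ γ κB σ W α G s T H μ c _ _ P _ w M hκ hγ hγ1 hB hκB hσ
    hα hs hT hK₀ hμ hw hind hc hH hM => (h dx du hdx A B K₀ κ γ κB σ W α G s T H μ c P w M hκ hγ hγ1
      hB hκB hσ hα hs hT hK₀.powerStable hμ hw hind hc hH hM).imp_right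
        fun hK K hKs => hK K hKs.powerStable⟩
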